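/- Let $I=[a,b]\subset\mathbb R$ with $a<b$, let $d,m,N\in\mathbb N_0$, and for $\ell \in \mathbb N_0$ let $H_\ell(I;\mathbb R^d)$ be the Sobolev space of functions $u\colon I\to\mathbb R^d$ whose weak derivatives up to order $\ell$ lie in $L_2(I;\mathbb R^d)$. For an open subset $U$ of a normed space $X$ and a normed space $Y$, let $C_b^n(U;Y)$ be the set of $n$ times continuously Fréchet differentiable maps $F\colon U\to Y$ such that $D^jF$ is bounded on $U$ and extends continuously to the closure $\overline U$, for all $j=0,\dots,n$ (in the operator norm on $j$-linear maps). Let $G\subset\mathbb R^d$ be open, let $f\in C_b^N(G;\mathbb R^m)$, and let $\mathcal G=\{u\in C(I;\mathbb R^d)\colon u(I)\subset G\}$. For $\ell\ge 1$ let $\mathcal G_\ell$ be any subset of $\mathcal G\cap H_\ell(I;\mathbb R^d)$ which is bounded and open in $H_\ell(I;\mathbb R^d)$ (where elements of $H_\ell(I;\mathbb R^d)$ are identified with their continuous representatives). Then the superposition operator $u\mapsto f\circ u$ belongs to $$ C_b^N(\mathcal G_1;L_2(I;\mathbb R^m))\;\cap\;\bigcap_{\substack{k+\ell\le N\\ \ell\ge1}}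 C_b^k(\mathcal G_\ell;H_\ell(I;\mathbb R^m)). $$ In each of these spaces its Fréchet derivatives are the superposition operators of the derivatives of $f$: for every order $j$ covered by the respective space (that is, $j\le N$ for the target $L_2$ and $j\le k$ for the target $H_\ell$), every $u\in\mathcal G_\ell$ (with $\ell=1$ for the target $L_2$) and all $h_1,\dots,h_j\in H_\ell(I;\mathbb R^d)$, $$ \bigl(D^j f(u)(h_1,\dots,h_j)\bigr)(x)=D^jf(u(x))\bigl(h_1(x),\dots,h_j(x)\bigr)\quad\text{for almost every }x\in I, $$ where $D^jf(u)$ on the left is the Fréchet derivative of the superposition operator and $D^jf(u(x))$ on the right is the derivative of $f$ as a function on $G\subset\mathbb R^d$. -/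

import Mathlib

open MeasureTheory Set
open scoped ContDiff

noncomputable section

/-- `v` is the weak derivative of order `j` of `u` on the interval `(a, b)`: for all smooth `φ` with
compact support in `(a, b)`, the integral of `φ^(j) u` is `(-1)^j` times the integral of `φ v`. -/
def IsWeakDeriv {E : Type*} [NormedAddCommGroup E] [NormedSpace ℝ E]
    (a b : ℝ) (j : ℕ) (u v : ℝ → E) : Prop :=
  ∀ φ : ℝ → ℝ, ContDiff ℝ ∞ φ → HasCompactSupport φ → tsupport φ ⊆ Ioo a b →
    ∫ x in Icc a b, iteratedDeriv j φ x • u x = (-1 : ℝ) ^ j • ∫ x in Icc a b, φ x • v x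

/-- The Lebesgue space `L₂([a, b]; E)`. -/
abbrev L2Space (a b : ℝ) (E : Type*) [NormedAddCommGroup E] : Type _ :=
  Lp E 2 (volume.restrict (Icc a b))

theorem integrable_smul_of_contDiff {E : Type*} [NormedAddCommGroup E] [NormedSpace ℝ E]
    {a b : ℝ} {φ : ℝ → ℝ} (hφ : Continuous φ) (u : L2Space a b E) :
    Integrable (fun x => φ x • u x) (volume.restrict (Icc a b)) := by
  have hu : IntegrableOn (fun x => u x) (Icc a b) volume :=
    (Lp.memLp u).integrable (by norm_num)
  exact hu.continuousOn_smul hφ.continuousOn isCompact_Icc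

/-- The Sobolev space of order `l` on `[a, b]` with values in `E`, as the space of all tuples
`(u, u', …, u^(l))` of `L₂` functions in which the entry with index `j` is the weak derivative of
order `j` of the entry with index `0`. (Weak derivatives are unique as elements of `L₂`, so that a
tuple is determined by its first entry.) The norm, inherited from the `ℓ²` product of `l + 1` copies
of `L₂`, is the usual one: the square root of the sum of the squares of the `L₂` norms of the weak
derivatives of order at most `l`. -/
def sobolevSubmodule (a b : ℝ) (l : ℕ) (E : Type*) [NormedAddCommGroup E] [NormedSpace ℝ E] :
    Submodule ℝ (PiLp 2 (fun _ : Fin (l + 1) => L2Space a b E)) where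
  carrier := {U | ∀ j : Fin (l + 1), IsWeakDeriv a b j (U 0) (U j)}
  zero_mem' := by
    intro j φ _ _ _
    have h0 : ((0 : L2Space a b E) : ℝ → E) =ᵐ[volume.restrict (Icc a b)] 0 := Lp.coeFn_zero _ _ _
    have key : ∀ ψ : ℝ → ℝ, ∫ x in Icc a b, ψ x • (0 : L2Space a b E) x = 0 := by
      intro ψ
      rw [← integral_zero ℝ E (μ := volume.restrict (Icc a b))]
      refine integral_congr_ae ?_
      filter_upwards [h0] with x hx
      rw [hx, Pi.zero_apply, smul_zero]
    simp only [PiLp.zero_apply]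
    rw [key, key, smul_zero]
  add_mem' := by
    intro U V hU hV j φ h1 h2 h3
    have key : ∀ ψ : ℝ → ℝ, Continuous ψ → ∀ u v : L2Space a b E,
        ∫ x in Icc a b, ψ x • (u + v) x
          = (∫ x in Icc a b, ψ x • u x) + ∫ x in Icc a b, ψ x • v x := by
      intro ψ hψ u v
      rw [← integral_add (integrable_smul_of_contDiff hψ u) (integrable_smul_of_contDiff hψ v)]
      refine integral_congr_ae ?_
      filter_upwards [Lp.coeFn_add u v] with x hx
      rw [hx, Pi.add_apply, smul_add]
    have hc : Continuous (iteratedDeriv (j : ℕ) φ) :=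
      h1.continuous_iteratedDeriv _ (by exact_mod_cast le_top)
    simp only [PiLp.add_apply]
    rw [key _ hc, key _ h1.continuous, hU j φ h1 h2 h3, hV j φ h1 h2 h3, smul_add]
  smul_mem' := by
    intro c U hU j φ h1 h2 h3
    have key : ∀ ψ : ℝ → ℝ, ∀ u : L2Space a b E,
        ∫ x in Icc a b, ψ x • (c • u) x = c • ∫ x in Icc a b, ψ x • u x := by
      intro ψ u
      rw [← integral_smul]
      refine integral_congr_ae ?_
      filter_upwards [Lp.coeFn_smul c u] with x hx
      rw [hx, Pi.smul_apply, smul_comm]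
    simp only [PiLp.smul_apply]
    rw [key, key, hU j φ h1 h2 h3, smul_comm]

/-- The Sobolev space `H_l([a, b]; ℝᵈ)`, a normed space. -/
abbrev Sobolev (a b : ℝ) (l d : ℕ) : Type :=
  sobolevSubmodule a b l (EuclideanSpace ℝ (Fin d))

/-- The `L₂` function underlying an element of the Sobolev space. -/
def Sobolev.toL2 {a b : ℝ} {l d : ℕ} (u : Sobolev a b l d) :
    L2Space a b (EuclideanSpace ℝ (Fin d)) := u.1 0

/-- The set of all `u` in `H_l([a, b]; ℝᵈ)` that are (i.e., have a representative which is)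
continuous on `[a, b]` with all values on `[a, b]` in `G`. -/
def Sobolev.continuousInto (a b : ℝ) (l : ℕ) {d : ℕ} (G : Set (EuclideanSpace ℝ (Fin d))) :
    Set (Sobolev a b l d) :=
  {u | ∃ v : ℝ → EuclideanSpace ℝ (Fin d), ContinuousOn v (Icc a b) ∧
    u.toL2 =ᵐ[volume.restrict (Icc a b)] v ∧ ∀ x ∈ Icc a b, v x ∈ G}

/-- `F` is of class `C_b^n` on the open subset `U` of a normed space: `F` is `n` times continuously
Fréchet differentiable on `U`, and its derivatives of order at most `n` (including `F` itself) are
bounded on `U` and extend continuously to the closure of `U`. -/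
structure IsCb {X Y : Type*} [NormedAddCommGroup X] [NormedSpace ℝ X]
    [NormedAddCommGroup Y] [NormedSpace ℝ Y] (n : ℕ) (F : X → Y) (U : Set X) : Prop where
  contDiffOn : ContDiffOn ℝ n F U
  bounded : ∀ j ≤ n, ∃ C : ℝ, ∀ x ∈ U, ‖iteratedFDeriv ℝ j F x‖ ≤ C
  extends_closure : ∀ j ≤ n, ∃ g : X → ContinuousMultilinearMap ℝ (fun _ : Fin j => X) Y,
    ContinuousOn g (closure U) ∧ EqOn g (iteratedFDeriv ℝ j F) U

end

/-! On continuous functions over a compact space, superposition with a $C^1$ function $f$ has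
derivative $h\mapsto f'(u)h$, that is, superposition with $f'$ followed by a bounded bilinear
pairing. Induction on the order shows that it inherits $C_b^n$ from $f$ (`IsCb.superpose`). Since
$H_1$ maps continuously into $C(I)$ and $C(I)$ into $L_2$, the statement for the target $L_2$
follows.

For the target $H_\ell$ put $F_0=f$ and
$F_{j+1}(y_0,\dots,y_{j+1})=DF_j(y_0,\dots,y_j)(y_1,\dots,y_{j+1})$. Then $(f\circ
u)^{(j+1)}=DF_j(u,\dots,u^{(j)})(u',\dots,u^{(j+1)})$ for $j<\ell$. The operator factor depends only
on the continuous functions $u,\dots,u^{(\ell-1)}$; the derivative that may be merely square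
integrable enters linearly. So every weak derivative of $f\circ u$ is a bounded bilinear image of a
superposition on continuous functions and a bounded linear map into $L_2$. This costs $j+1\le\ell$
derivatives of $f$, whence $k+\ell\le N$. Boundedness of $\mathcal G_\ell$ keeps the jets in a
bounded set and makes the linear factor $C_b^k$.

The weak chain rule (`isWeakDeriv_superpose`) is integration by parts for continuous derivatives,
extended to $L_2$ by density. Finally, $H_\ell$ is closed in the product of $L_2$ spaces, so
orthogonal projection turns the tuple of derivatives into a $C_b^k$ map into $H_\ell$. -/

open MeasureTheory Set
open scoped ContDiff

noncomputable section

/-! ### Calculus of bounded maps with continuous extension and of $C_b^n$ maps -/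

/-- `F` is bounded on `U` and extends continuously to the closure of `U`. -/
def ExtendsBounded {X Y : Type*} [TopologicalSpace X] [NormedAddCommGroup Y]
    (F : X → Y) (U : Set X) : Prop :=
  (∃ C : ℝ, ∀ x ∈ U, ‖F x‖ ≤ C) ∧ ∃ g : X → Y, ContinuousOn g (closure U) ∧ EqOn g F U

namespace ExtendsBounded

variable {X X' Y Y₁ Y₂ Z : Type*} [TopologicalSpace X] [TopologicalSpace X']
  [NormedAddCommGroup Y] [NormedAddCommGroup Y₁] [NormedAddCommGroup Y₂] [NormedAddCommGroup Z]
  {F F' : X → Y} {U : Set X}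

theorem continuousOn (h : ExtendsBounded F U) : ContinuousOn F U := by
  obtain ⟨-, g, hg, hgF⟩ := h
  exact (hg.mono subset_closure).congr hgF.symm

theorem congr (h : ExtendsBounded F U) (hF : EqOn F' F U) : ExtendsBounded F' U := by
  obtain ⟨⟨C, hC⟩, g, hg, hgF⟩ := h
  exact ⟨⟨C, fun x hx => by rw [hF hx]; exact hC x hx⟩, g, hg, hgF.trans hF.symm⟩

theorem add (h : ExtendsBounded F U) (h' : ExtendsBounded F' U) :
    ExtendsBounded (fun x => F x + F' x) U := by
  obtain ⟨⟨C, hC⟩, g, hg, hgF⟩ := h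
  obtain ⟨⟨C', hC'⟩, g', hg', hgF'⟩ := h'
  exact ⟨⟨C + C', fun x hx => norm_add_le_of_le (hC x hx) (hC' x hx)⟩, fun x => g x + g' x,
    hg.add hg', fun x hx => by simp only [hgF hx, hgF' hx]⟩

theorem comp_right (h : ExtendsBounded F U) {L : X' → X} (hL : Continuous L) {V : Set X'}
    (hV : MapsTo L V U) : ExtendsBounded (fun x => F (L x)) V := by
  obtain ⟨⟨C, hC⟩, g, hg, hgF⟩ := h
  exact ⟨⟨C, fun x hx => hC _ (hV hx)⟩, fun x => g (L x),
    hg.comp hL.continuousOn (hV.closure hL), fun x hx => hgF (hV hx)⟩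

theorem comp_left (h : ExtendsBounded F U) {L : Y → Z} (hL : Continuous L)
    (hn : ∀ y, ‖L y‖ = ‖y‖) : ExtendsBounded (fun x => L (F x)) U := by
  obtain ⟨⟨C, hC⟩, g, hg, hgF⟩ := h
  exact ⟨⟨C, fun x hx => (hn _).trans_le (hC x hx)⟩, fun x => L (g x),
    hL.comp_continuousOn hg, fun x hx => by simp only [hgF hx]⟩

variable [NormedSpace ℝ Y] [NormedSpace ℝ Y₁] [NormedSpace ℝ Y₂] [NormedSpace ℝ Z]

theorem clm_comp (L : Y →L[ℝ] Z) (h : ExtendsBounded F U) :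
    ExtendsBounded (fun x => L (F x)) U := by
  obtain ⟨⟨C, hC⟩, g, hg, hgF⟩ := h
  refine ⟨⟨‖L‖ * C, fun x hx => L.le_opNorm_of_le (hC x hx)⟩, fun x => L (g x),
    L.continuous.comp_continuousOn hg, fun x hx => by simp only [hgF hx]⟩

theorem bilinear (B : Y₁ →L[ℝ] Y₂ →L[ℝ] Z) {F₁ : X → Y₁} {F₂ : X → Y₂}
    (h₁ : ExtendsBounded F₁ U) (h₂ : ExtendsBounded F₂ U) :
    ExtendsBounded (fun x => B (F₁ x) (F₂ x)) U := by
  obtain ⟨⟨C, hC⟩, g, hg, hgF⟩ := h₁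
  obtain ⟨⟨C', hC'⟩, g', hg', hgF'⟩ := h₂
  refine ⟨⟨‖B‖ * C * C', fun x hx => B.le_of_opNorm₂_le_of_le le_rfl (hC x hx) (hC' x hx)⟩,
    fun x => B (g x) (g' x), ?_, fun x hx => by simp only [hgF hx, hgF' hx]⟩
  exact (B.continuous.comp_continuousOn hg).clm_apply hg'

end ExtendsBounded

section IsCbCalculus

variable {X X' Y Y₁ Y₂ Z : Type} [NormedAddCommGroup X] [NormedSpace ℝ X]
  [NormedAddCommGroup X'] [NormedSpace ℝ X']
  [NormedAddCommGroup Y] [NormedSpace ℝ Y] [NormedAddCommGroup Y₁] [NormedSpace ℝ Y₁]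
  [NormedAddCommGroup Y₂] [NormedSpace ℝ Y₂] [NormedAddCommGroup Z] [NormedSpace ℝ Z]
  {n : ℕ} {F F' : X → Y} {U : Set X}

theorem isCb_iff : IsCb n F U ↔
    ContDiffOn ℝ n F U ∧ ∀ j ≤ n, ExtendsBounded (iteratedFDeriv ℝ j F) U :=
  ⟨fun h => ⟨h.contDiffOn, fun j hj => ⟨h.bounded j hj, h.extends_closure j hj⟩⟩,
    fun h => ⟨h.1, fun j hj => (h.2 j hj).1, fun j hj => (h.2 j hj).2⟩⟩

theorem extendsBounded_iteratedFDeriv_zero :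
    ExtendsBounded (iteratedFDeriv ℝ 0 F) U ↔ ExtendsBounded F U := by
  let e := continuousMultilinearCurryFin0 ℝ X Y
  refine ⟨fun h => ?_, fun h => ?_⟩
  · exact h.comp_left (L := e) e.continuous e.norm_map
  · exact h.comp_left (L := e.symm) e.symm.continuous e.symm.norm_map

theorem extendsBounded_iteratedFDeriv_succ {j : ℕ} :
    ExtendsBounded (iteratedFDeriv ℝ (j + 1) F) U ↔
      ExtendsBounded (iteratedFDeriv ℝ j (fderiv ℝ F)) U := by
  let e := continuousMultilinearCurryRightEquiv' ℝ j X Y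
  have h1 : ∀ x, iteratedFDeriv ℝ (j + 1) F x = e.symm (iteratedFDeriv ℝ j (fderiv ℝ F) x) :=
    fun x => iteratedFDeriv_succ_eq_comp_right
  refine ⟨fun h => ?_, fun h => ?_⟩
  · refine (h.comp_left (L := e) e.continuous e.norm_map).congr fun x _ => ?_
    simp only [h1, e.apply_symm_apply]
  · refine (h.comp_left (L := e.symm) e.symm.continuous e.symm.norm_map).congr fun x _ => h1 x

theorem isCb_zero_iff : IsCb 0 F U ↔ ExtendsBounded F U := by
  rw [isCb_iff]
  refine ⟨fun h => extendsBounded_iteratedFDeriv_zero.1 (h.2 0 le_rfl), fun h => ⟨?_, ?_⟩⟩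
  · exact contDiffOn_zero.2 h.continuousOn
  · intro j hj
    obtain rfl := Nat.le_zero.1 hj
    exact extendsBounded_iteratedFDeriv_zero.2 h

/-- The recursion behind the inductions on the order below. They replace the target space by a space
of operators, so it must be generalized; keeping all spaces in `Type` makes this possible. -/
theorem isCb_succ_iff (hU : IsOpen U) : IsCb (n + 1) F U ↔
    ExtendsBounded F U ∧ DifferentiableOn ℝ F U ∧ IsCb n (fderiv ℝ F) U := by
  have hc : ContDiffOn ℝ (n + 1 : ℕ) F U ↔
      DifferentiableOn ℝ F U ∧ ContDiffOn ℝ n (fderiv ℝ F) U := by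
    rw [Nat.cast_add, Nat.cast_one, contDiffOn_succ_iff_fderiv_of_isOpen hU]
    simp
  rw [isCb_iff, isCb_iff, hc]
  constructor
  · rintro ⟨⟨h1, h2⟩, h3⟩
    exact ⟨extendsBounded_iteratedFDeriv_zero.1 (h3 0 (Nat.zero_le _)), h1, h2,
      fun j hj => extendsBounded_iteratedFDeriv_succ.1 (h3 (j + 1) (by omega))⟩
  · rintro ⟨h0, h1, h2, h3⟩
    refine ⟨⟨h1, h2⟩, fun j hj => ?_⟩
    cases j with
    | zero => exact extendsBounded_iteratedFDeriv_zero.2 h0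
    | succ j => exact extendsBounded_iteratedFDeriv_succ.2 (h3 j (by omega))

namespace IsCb

theorem mono_order {k : ℕ} (h : IsCb n F U) (hk : k ≤ n) : IsCb k F U :=
  ⟨h.contDiffOn.of_le (by exact_mod_cast hk), fun j hj => h.bounded j (hj.trans hk),
    fun j hj => h.extends_closure j (hj.trans hk)⟩

theorem extendsBounded (h : IsCb n F U) : ExtendsBounded F U :=
  isCb_zero_iff.1 (h.mono_order (Nat.zero_le _))

theorem congr (hU : IsOpen U) (h : IsCb n F U) (hF : EqOn F' F U) : IsCb n F' U := by
  rw [isCb_iff] at h ⊢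
  refine ⟨h.1.congr hF, fun j hj => (h.2 j hj).congr fun x hx => ?_⟩
  exact ((hF.eventuallyEq_of_mem (hU.mem_nhds hx)).iteratedFDeriv ℝ j).eq_of_nhds

theorem clm_comp (hU : IsOpen U) (L : Y →L[ℝ] Z) (h : IsCb n F U) :
    IsCb n (fun x => L (F x)) U := by
  induction n generalizing Y Z with
  | zero => rw [isCb_zero_iff] at h ⊢; exact h.clm_comp L
  | succ n ih =>
    rw [isCb_succ_iff hU] at h ⊢
    refine ⟨h.1.clm_comp L, L.differentiable.comp_differentiableOn h.2.1, ?_⟩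
    refine (ih (ContinuousLinearMap.compL ℝ X Y Z L) h.2.2).congr hU fun x hx => ?_
    have hd := (h.2.1 x hx).differentiableAt (hU.mem_nhds hx)
    exact (L.hasFDerivAt.comp x hd.hasFDerivAt).fderiv

theorem add (hU : IsOpen U) (h : IsCb n F U) (h' : IsCb n F' U) :
    IsCb n (fun x => F x + F' x) U := by
  induction n generalizing Y with
  | zero => rw [isCb_zero_iff] at *; exact h.add h'
  | succ n ih =>
    rw [isCb_succ_iff hU] at *
    refine ⟨h.1.add h'.1, h.2.1.add h'.2.1, (ih h.2.2 h'.2.2).congr hU fun x hx => ?_⟩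
    exact fderiv_fun_add ((h.2.1 x hx).differentiableAt (hU.mem_nhds hx))
      ((h'.2.1 x hx).differentiableAt (hU.mem_nhds hx))

/-- By the product rule the derivative is a sum of two bilinear expressions, each in one factor and
the derivative of the other, so the induction closes. -/
theorem bilinear (hU : IsOpen U) (B : Y₁ →L[ℝ] Y₂ →L[ℝ] Z) {F₁ : X → Y₁} {F₂ : X → Y₂}
    (h₁ : IsCb n F₁ U) (h₂ : IsCb n F₂ U) : IsCb n (fun x => B (F₁ x) (F₂ x)) U := by
  induction n generalizing Y₁ Y₂ Z with
  | zero => rw [isCb_zero_iff] at *; exact h₁.bilinear B h₂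
  | succ n ih =>
    have h₁' := h₁.mono_order n.le_succ
    have h₂' := h₂.mono_order n.le_succ
    rw [isCb_succ_iff hU] at *
    have hd₁ := fun x hx => (h₁.2.1 x hx).differentiableAt (hU.mem_nhds hx)
    have hd₂ := fun x hx => (h₂.2.1 x hx).differentiableAt (hU.mem_nhds hx)
    refine ⟨h₁.1.bilinear B h₂.1, fun x hx => ?_, ?_⟩
    · exact (B.hasFDerivAt_of_bilinear (hd₁ x hx).hasFDerivAt
        (hd₂ x hx).hasFDerivAt).differentiableAt.differentiableWithinAt
    · exact ((ih (B.precompR X) h₁' h₂.2.2).add hU (ih (B.precompL X) h₁.2.2 h₂')).congr hU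
        fun x hx => B.fderiv_of_bilinear (hd₁ x hx) (hd₂ x hx)

theorem comp_clm (hU : IsOpen U) (h : IsCb n F U) (L : X' →L[ℝ] X) {V : Set X'}
    (hV : IsOpen V) (hVU : MapsTo L V U) : IsCb n (fun x => F (L x)) V := by
  induction n generalizing Y with
  | zero => rw [isCb_zero_iff] at *; exact h.comp_right L.continuous hVU
  | succ n ih =>
    rw [isCb_succ_iff hU] at h
    rw [isCb_succ_iff hV]
    have hd := fun x hx => ((h.2.1 (L x) (hVU hx)).differentiableAt
      (hU.mem_nhds (hVU hx))).hasFDerivAt.comp x L.hasFDerivAt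
    refine ⟨h.1.comp_right L.continuous hVU, fun x hx =>
      (hd x hx).differentiableAt.differentiableWithinAt, ?_⟩
    refine ((ih h.2.2).clm_comp hV ((ContinuousLinearMap.compL ℝ X' X Y).flip L)).congr hV
      fun x hx => ?_
    exact (hd x hx).fderiv

/-- Boundedness of `U` is needed only for the map itself; its derivative is constant. -/
theorem clm (L : X →L[ℝ] Y) (hU : IsOpen U) (hb : Bornology.IsBounded U) : IsCb n L U := by
  have h0 : ExtendsBounded L U := by
    obtain ⟨C, hC⟩ := hb.exists_norm_le
    exact ⟨⟨‖L‖ * C, fun x hx => L.le_opNorm_of_le (hC x hx)⟩, L, L.continuous.continuousOn,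
      eqOn_refl _ _⟩
  have hconst : ∀ (n : ℕ) {W : Type} [NormedAddCommGroup W] [NormedSpace ℝ W] (w : W),
      IsCb n (fun _ : X => w) U := by
    intro n
    induction n with
    | zero =>
      intro W _ _ w
      exact isCb_zero_iff.2 ⟨⟨‖w‖, fun _ _ => le_rfl⟩, fun _ => w, continuousOn_const,
        eqOn_refl _ _⟩
    | succ n ih =>
      intro W _ _ w
      rw [isCb_succ_iff hU]
      refine ⟨(ih w).extendsBounded, differentiableOn_const _, ?_⟩
      exact (ih (0 : X →L[ℝ] W)).congr hU fun x _ => by simp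
  cases n with
  | zero => exact isCb_zero_iff.2 h0
  | succ n =>
    rw [isCb_succ_iff hU]
    exact ⟨h0, L.differentiable.differentiableOn, (hconst n L).congr hU fun x _ => L.fderiv⟩

theorem pi {ι : Type} [Fintype ι] {W : ι → Type} [∀ i, NormedAddCommGroup (W i)]
    [∀ i, NormedSpace ℝ (W i)] {F : X → ∀ i, W i} (hU : IsOpen U)
    (h : ∀ i, IsCb n (fun x => F x i) U) : IsCb n F U := by
  classical
  have key : ∀ s : Finset ι, IsCb n
      (fun x => ∑ i ∈ s, ContinuousLinearMap.single ℝ W i (F x i)) U := by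
    intro s
    induction s using Finset.induction_on with
    | empty =>
      simp only [Finset.sum_empty]
      exact isCb_iff.2 ⟨contDiffOn_const, fun j _ => ⟨⟨0, fun x _ => by simp⟩,
        fun _ => 0, continuousOn_const, fun x _ => by simp⟩⟩
    | insert i s hi ih =>
      simp only [Finset.sum_insert hi]
      exact ((h i).clm_comp hU _).add hU ih
  refine (key Finset.univ).congr hU fun x _ => ?_
  ext i
  simp [Finset.sum_apply]

end IsCb

end IsCbCalculus

/-! ### Superposition operators on spaces of continuous functions -/

section Nemytskii

open Topology

variable {K : Type} [TopologicalSpace K]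
  {E F : Type} [NormedAddCommGroup E] [NormedAddCommGroup F]

open Classical in
/-- The superposition operator `u ↦ f ∘ u` on spaces of continuous functions (with the value `0`
where `f ∘ u` is not continuous). -/
def superpose (f : E → F) (u : C(K, E)) : C(K, F) :=
  if h : Continuous fun x => f (u x) then ⟨_, h⟩ else 0

theorem superpose_apply {f : E → F} {S : Set E} (hf : ContinuousOn f S) {u : C(K, E)}
    (hu : ∀ x, u x ∈ S) (x : K) : superpose f u x = f (u x) := by
  have h : Continuous fun x => f (u x) := hf.comp_continuous u.continuous hu
  simp [superpose, h]

/-- Functions with values in `S` form a copy of `C(K, S)` with the induced topology, on which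
postcomposition is continuous for the compact-open topology. No openness of `S` is required, so the
result also applies to the extension of a function to `closure S`. -/
theorem continuousOn_superpose {g : E → F} {S : Set E} (hg : ContinuousOn g S) :
    ContinuousOn (superpose g) {u : C(K, E) | ∀ x, u x ∈ S} := by
  rw [continuousOn_iff_continuous_domRestrict]
  let cod : {u : C(K, E) | ∀ x, u x ∈ S} → C(K, S) := fun u =>
    ⟨fun x => ⟨u.1 x, u.2 x⟩, u.1.continuous.subtype_mk _⟩
  let incl : C(S, E) := ⟨Subtype.val, continuous_subtype_val⟩
  have hcod : Continuous cod :=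
    (incl.isInducing_postcomp Topology.IsInducing.subtypeVal).continuous_iff.2
      continuous_subtype_val
  let g' : C(S, F) := ⟨S.domRestrict g, continuousOn_iff_continuous_domRestrict.1 hg⟩
  refine ((ContinuousMap.continuous_postcomp g').comp hcod).congr fun u => ?_
  ext x
  exact (superpose_apply hg u.2 x).symm

theorem closure_setOf_forall_mem_subset (S : Set E) :
    closure {u : C(K, E) | ∀ x, u x ∈ S} ⊆ {u | ∀ x, u x ∈ closure S} := fun _ hu x =>
  (show MapsTo (fun u : C(K, E) => u x) {u | ∀ x, u x ∈ S} S from fun _ hv => hv x).closure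
    (continuous_eval_const x) hu

variable [CompactSpace K]

theorem isOpen_setOf_forall_mem {S : Set E} (hS : IsOpen S) :
    IsOpen {u : C(K, E) | ∀ x, u x ∈ S} := by
  simpa [MapsTo] using ContinuousMap.isOpen_setOfPred_mapsTo (isCompact_univ (X := K)) hS

theorem ExtendsBounded.superpose {f : E → F} {S : Set E} (hf : ExtendsBounded f S) :
    ExtendsBounded (superpose f) {u : C(K, E) | ∀ x, u x ∈ S} := by
  have hfc := hf.continuousOn
  obtain ⟨⟨C, hC⟩, g, hg, hgf⟩ := hf
  refine ⟨⟨max C 0, fun u hu => ?_⟩, _root_.superpose g,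
    (continuousOn_superpose hg).mono (closure_setOf_forall_mem_subset S), fun u hu => ?_⟩
  · refine (ContinuousMap.norm_le _ (le_max_right _ _)).2 fun x => ?_
    rw [superpose_apply hfc hu]
    exact (hC _ (hu x)).trans (le_max_left _ _)
  · ext x
    rw [superpose_apply hg (fun x => subset_closure (hu x)), superpose_apply hfc hu, hgf (hu x)]

variable [NormedSpace ℝ E] [NormedSpace ℝ F]

/-- Pointwise application of a continuous family of operators to a continuous function. -/
def pointwiseApply : C(K, E →L[ℝ] F) →L[ℝ] C(K, E) →L[ℝ] C(K, F) :=
  LinearMap.mkContinuous₂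
    (LinearMap.mk₂ ℝ (fun (A : C(K, E →L[ℝ] F)) (h : C(K, E)) =>
        (⟨fun x => A x (h x), A.continuous.clm_apply h.continuous⟩ : C(K, F)))
      (fun A B h => by ext; simp) (fun c A h => by ext; simp) (fun A h k => by ext; simp)
      (fun c A h => by ext; simp)) 1
    (fun A h => by
      refine (ContinuousMap.norm_le _ (by positivity)).2 fun x => ?_
      rw [one_mul]
      exact (A x).le_of_opNorm_le_of_le (A.norm_coe_le_norm x) (h.norm_coe_le_norm x))

@[simp]
theorem pointwiseApply_apply (A : C(K, E →L[ℝ] F)) (h : C(K, E)) (x : K) :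
    pointwiseApply A h x = A x (h x) := rfl

/-- The range of `u` is compact, so `fderiv ℝ f` is uniformly continuous near it; the mean value
inequality then gives a remainder estimate uniform in `x`. -/
theorem hasFDerivAt_superpose {f : E → F} {S : Set E} (hS : IsOpen S)
    (hf : DifferentiableOn ℝ f S) (hf' : ContinuousOn (fderiv ℝ f) S) {u : C(K, E)}
    (hu : ∀ x, u x ∈ S) :
    HasFDerivAt (superpose f) (pointwiseApply (superpose (fderiv ℝ f) u)) u := by
  have hev : ∀ᶠ v : C(K, E) in 𝓝 u, ∀ x, v x ∈ S := (isOpen_setOf_forall_mem hS).mem_nhds hu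
  rw [hasFDerivAt_iff_isLittleO, Asymptotics.isLittleO_iff]
  intro ε hε
  have hKc : IsCompact (range u) := isCompact_range u.continuous
  have hKS : range u ⊆ S := range_subset_iff.2 hu
  have h1 := hKc.uniformContinuousAt_of_continuousAt (fderiv ℝ f)
    (fun y hy => hf'.continuousAt (hS.mem_nhds (hKS hy))) (Metric.dist_mem_uniformity hε)
  obtain ⟨δ₁, hδ₁, h1⟩ := Metric.mem_uniformity_dist.1 h1
  -- The second radius keeps the balls around the values of `u` inside `S`, where `f` is
  -- differentiable.
  obtain ⟨δ₂, hδ₂, h2⟩ := hKc.exists_thickening_subset_open hS hKS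
  filter_upwards [hev, Metric.ball_mem_nhds u (lt_min hδ₁ hδ₂)] with v hv hvu
  refine (ContinuousMap.norm_le _ (by positivity)).2 fun x => ?_
  simp only [ContinuousMap.sub_apply, pointwiseApply_apply, superpose_apply hf.continuousOn hv,
    superpose_apply hf.continuousOn hu, superpose_apply hf' hu]
  have hball : Metric.ball (u x) (min δ₁ δ₂) ⊆ S := fun y hy => h2
    (Metric.mem_thickening_iff.2 ⟨u x, mem_range_self x, hy.trans_le (min_le_right _ _)⟩)
  have hvx : v x ∈ Metric.ball (u x) (min δ₁ δ₂) :=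
    (ContinuousMap.dist_apply_le_dist x).trans_lt hvu
  refine ((convex_ball (u x) (min δ₁ δ₂)).norm_image_sub_le_of_norm_hasFDerivWithin_le'
    (fun y hy => ((hf y (hball hy)).differentiableAt
      (hS.mem_nhds (hball hy))).hasFDerivAt.hasFDerivWithinAt)
    (C := ε) (fun y hy => ?_) (Metric.mem_ball_self (lt_min hδ₁ hδ₂)) hvx).trans ?_
  · rw [← dist_eq_norm, dist_comm]
    refine (h1 (?_ : dist (u x) y < δ₁) (mem_range_self x)).le
    rw [dist_comm]
    exact (Metric.mem_ball.1 hy).trans_le (min_le_left _ _)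
  · gcongr
    exact (v - u).norm_coe_le_norm x

theorem IsCb.superpose {n : ℕ} {f : E → F} {S : Set E} (hS : IsOpen S) (hf : IsCb n f S) :
    IsCb n (superpose f) {u : C(K, E) | ∀ x, u x ∈ S} := by
  have hO := isOpen_setOf_forall_mem (K := K) hS
  induction n generalizing F with
  | zero => rw [isCb_zero_iff] at *; exact hf.superpose
  | succ n ih =>
    rw [isCb_succ_iff hS] at hf
    rw [isCb_succ_iff hO]
    have hd := fun u hu => hasFDerivAt_superpose (K := K) (u := u) hS hf.2.1
      hf.2.2.extendsBounded.continuousOn hu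
    exact ⟨hf.1.superpose, fun u hu => (hd u hu).differentiableAt.differentiableWithinAt,
      ((ih hf.2.2).clm_comp hO pointwiseApply).congr hO fun u hu => (hd u hu).fderiv⟩

/-- Induction on the order, splitting off the last argument: the bounded linear map `pointwiseApply`
commutes with the remaining `n` derivatives. -/
theorem iteratedFDeriv_superpose_apply {n : ℕ} {f : E → F} {S : Set E} (hS : IsOpen S)
    (hf : IsCb n f S) {u : C(K, E)} (hu : ∀ x, u x ∈ S) (h : Fin n → C(K, E)) (x : K) :
    iteratedFDeriv ℝ n (_root_.superpose f) u h x =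
      iteratedFDeriv ℝ n f (u x) fun i => h i x := by
  have hO := isOpen_setOf_forall_mem (K := K) hS
  induction n generalizing F with
  | zero => simp [superpose_apply hf.extendsBounded.continuousOn hu]
  | succ n ih =>
    have hf' := (isCb_succ_iff hS).1 hf
    have hd : EqOn (fderiv ℝ (_root_.superpose f))
        (pointwiseApply ∘ _root_.superpose (fderiv ℝ f)) {u : C(K, E) | ∀ x, u x ∈ S} :=
      fun u hu => (hasFDerivAt_superpose (K := K) (u := u) hS hf'.2.1
        hf'.2.2.extendsBounded.continuousOn hu).fderiv
    have hc : ContDiffAt ℝ n (_root_.superpose (fderiv ℝ f)) u :=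
      (hf'.2.2.superpose hS).contDiffOn.contDiffAt (hO.mem_nhds hu)
    rw [iteratedFDeriv_succ_apply_right, iteratedFDeriv_succ_apply_right,
      ((hd.eventuallyEq_of_mem (hO.mem_nhds hu)).iteratedFDeriv ℝ n).eq_of_nhds,
      ContinuousLinearMap.iteratedFDeriv_comp_left _ hc le_rfl]
    simp only [ContinuousLinearMap.compContinuousMultilinearMap_coe, Function.comp_apply,
      pointwiseApply_apply]
    rw [ih hf'.2.2]
    rfl

end Nemytskii

/-! ### Primitives, weak derivatives and the weak chain rule on an interval -/

section IntervalSpaces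

open Topology ENNReal BoundedContinuousFunction

variable {a b : ℝ} (hab : a ≤ b) {V W : Type} [NormedAddCommGroup V] [NormedAddCommGroup W]

theorem L2Space.integrableOn (v : L2Space a b V) : IntegrableOn v (Icc a b) :=
  (Lp.memLp v).integrable (by norm_num)

theorem L2Space.integral_norm_le (v : L2Space a b V) :
    ∫ x in Icc a b, ‖v x‖ ≤ ‖v‖ * (volume.restrict (Icc a b) univ ^ (1 / 2 : ℝ)).toReal := by
  have h1 : ∫ x in Icc a b, ‖v x‖ = (eLpNorm v 1 (volume.restrict (Icc a b))).toReal := by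
    rw [eLpNorm_one_eq_lintegral_enorm, integral_norm_eq_lintegral_enorm (Lp.aestronglyMeasurable v)]
  have h2 := eLpNorm_le_eLpNorm_mul_rpow_measure_univ (p := 1) (q := 2)
    (μ := volume.restrict (Icc a b)) (by norm_num) (Lp.aestronglyMeasurable v)
  rw [h1, Lp.norm_def, ← ENNReal.toReal_mul]
  refine ENNReal.toReal_mono ?_ (h2.trans_eq ?_)
  · refine ENNReal.mul_ne_top (Lp.eLpNorm_ne_top v) ?_
    exact (ENNReal.rpow_lt_top_of_nonneg (by norm_num) (measure_ne_top _ _)).ne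
  · norm_num

variable [NormedSpace ℝ V] [NormedSpace ℝ W]

theorem L2Space.continuous_integral_Ioc (v : L2Space a b V) :
    Continuous fun x : Icc a b => ∫ t in Ioc a (x : ℝ), v t := by
  have := intervalIntegral.continuousOn_primitive (L2Space.integrableOn v)
  exact continuousOn_iff_continuous_domRestrict.1 this

/-- The constant extension of continuous functions on `[a, b]` to `ℝ`. -/
def extendConst : C(Icc a b, V) →L[ℝ] ℝ →ᵇ V :=
  LinearMap.mkContinuous
    { toFun := fun w => BoundedContinuousFunction.ofNormedAddCommGroup (IccExtend hab w)
        (w.continuous.Icc_extend' (h := hab)) ‖w‖ fun _ => w.norm_coe_le_norm _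
      map_add' := fun _ _ => rfl
      map_smul' := fun _ _ => rfl } 1 fun w => by
    rw [one_mul]
    exact (BoundedContinuousFunction.norm_le (norm_nonneg w)).2 fun _ => w.norm_coe_le_norm _

/-- The inclusion of the continuous functions on `[a, b]` into `L_p([a, b])`. -/
def continuousToLp (p : ℝ≥0∞) [Fact (1 ≤ p)] :
    C(Icc a b, V) →L[ℝ] Lp V p (volume.restrict (Icc a b)) :=
  (BoundedContinuousFunction.toLp p _ ℝ).comp (extendConst hab)

theorem coeFn_continuousToLp (p : ℝ≥0∞) [Fact (1 ≤ p)] (w : C(Icc a b, V)) :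
    continuousToLp hab p w =ᵐ[volume.restrict (Icc a b)] IccExtend hab w :=
  BoundedContinuousFunction.coeFn_toLp p _ ℝ (extendConst hab w)

/-- Multiplication of a square integrable function by a continuous family of operators. -/
def applyL2 : C(Icc a b, V →L[ℝ] W) →L[ℝ] L2Space a b V →L[ℝ] L2Space a b W :=
  ((ContinuousLinearMap.id ℝ (V →L[ℝ] W)).holderL (volume.restrict (Icc a b)) ∞ 2 2).comp
    (continuousToLp hab ∞)

theorem coeFn_applyL2 (A : C(Icc a b, V →L[ℝ] W)) (v : L2Space a b V) :
    applyL2 hab A v =ᵐ[volume.restrict (Icc a b)] fun x => IccExtend hab A x (v x) := by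
  filter_upwards [(ContinuousLinearMap.id ℝ (V →L[ℝ] W)).coeFn_holder (r := 2)
    (continuousToLp hab ∞ A) v, coeFn_continuousToLp hab ∞ A] with x h1 h2
  rw [← h2]
  exact h1

/-- The primitive vanishing at `a` of a square integrable function on `[a, b]`. -/
def primitive : L2Space a b V →L[ℝ] C(Icc a b, V) :=
  LinearMap.mkContinuous
    { toFun := fun v => ⟨_, L2Space.continuous_integral_Ioc v⟩
      map_add' := fun v w => by
        ext x
        have hx : Ioc a (x : ℝ) ⊆ Icc a b := Ioc_subset_Icc_self.trans (Icc_subset_Icc_right x.2.2)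
        simp only [ContinuousMap.coe_mk, ContinuousMap.add_apply]
        rw [← integral_add ((L2Space.integrableOn v).mono_set hx)
          ((L2Space.integrableOn w).mono_set hx)]
        exact integral_congr_ae (ae_restrict_of_ae_restrict_of_subset hx (Lp.coeFn_add v w))
      map_smul' := fun c v => by
        ext x
        have hx : Ioc a (x : ℝ) ⊆ Icc a b := Ioc_subset_Icc_self.trans (Icc_subset_Icc_right x.2.2)
        simp only [ContinuousMap.coe_mk, ContinuousMap.smul_apply, RingHom.id_apply]
        rw [← integral_smul]
        exact integral_congr_ae (ae_restrict_of_ae_restrict_of_subset hx (Lp.coeFn_smul c v)) }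
    (volume.restrict (Icc a b) univ ^ (1 / 2 : ℝ)).toReal fun v => by
    refine (ContinuousMap.norm_le _ (by positivity)).2 fun x => ?_
    have hx : Ioc a (x : ℝ) ⊆ Icc a b := Ioc_subset_Icc_self.trans (Icc_subset_Icc_right x.2.2)
    refine (norm_integral_le_integral_norm _).trans ?_
    rw [mul_comm]
    exact (setIntegral_mono_set (L2Space.integrableOn v).norm (ae_of_all _ fun _ => norm_nonneg _)
      hx.eventuallyLE).trans (L2Space.integral_norm_le v)

theorem primitive_apply (v : L2Space a b V) (x : Icc a b) :
    primitive v x = ∫ t in Ioc a (x : ℝ), v t := rfl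

theorem continuous_setIntegral_L2Space :
    Continuous fun v : L2Space a b V => ∫ x in Icc a b, v x := by
  by_cases hab : a ≤ b
  · have : (fun v : L2Space a b V => ∫ x in Icc a b, v x) =
        fun v => primitive v ⟨b, right_mem_Icc.2 hab⟩ := by
      ext v
      rw [primitive_apply, integral_Icc_eq_integral_Ioc]
    rw [this]
    fun_prop
  · simp [Icc_eq_empty hab, continuous_const]

theorem continuous_setIntegral_smul {ψ : ℝ → ℝ} (hψ : Continuous ψ) :
    Continuous fun v : L2Space a b V => ∫ x in Icc a b, ψ x • v x := by
  by_cases hab : a ≤ b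
  -- Multiplication by `ψ` is a special case of `applyL2`, hence bounded on $L_2$.
  · let A : C(Icc a b, V →L[ℝ] V) :=
      ⟨fun x => ψ x • ContinuousLinearMap.id ℝ V, by fun_prop⟩
    have : (fun v : L2Space a b V => ∫ x in Icc a b, ψ x • v x) =
        fun v => ∫ x in Icc a b, applyL2 hab A v x := by
      ext v
      refine integral_congr_ae ?_
      filter_upwards [coeFn_applyL2 hab A v, ae_restrict_mem measurableSet_Icc] with x h1 h2
      rw [h1, IccExtend_of_mem hab _ h2]
      simp [A]
    rw [this]
    exact continuous_setIntegral_L2Space.comp (applyL2 hab A).continuous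
  · simp [Icc_eq_empty hab, continuous_const]

theorem eq_zero_of_tsupport_subset_Ioo {φ : ℝ → ℝ} (h : tsupport φ ⊆ Ioo a b) {x : ℝ}
    (hx : x ∉ Ioo a b) : φ x = 0 := image_eq_zero_of_notMem_tsupport fun h' => hx (h h')

theorem IsWeakDeriv.succ {j : ℕ} {u v w : ℝ → V} (h : IsWeakDeriv a b j u v)
    (h' : IsWeakDeriv a b 1 v w) : IsWeakDeriv a b (j + 1) u w := by
  intro φ h1 h2 h3
  have hd : ContDiff ℝ ∞ (deriv φ) := (contDiff_infty_iff_deriv.1 h1).2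
  have e1 := h (deriv φ) hd h2.deriv ((tsupport_deriv_subset (f := φ)).trans h3)
  have e2 := h' φ h1 h2 h3
  rw [iteratedDeriv_one] at e2
  rw [iteratedDeriv_succ', e1, e2, smul_smul, pow_one, pow_succ]

theorem IsWeakDeriv.of_succ {j : ℕ} {u v w : ℝ → V} (h : IsWeakDeriv a b j u v)
    (h' : IsWeakDeriv a b (j + 1) u w) : IsWeakDeriv a b 1 v w := by
  intro φ h1 h2 h3
  have hd : ContDiff ℝ ∞ (deriv φ) := (contDiff_infty_iff_deriv.1 h1).2
  have e1 := h (deriv φ) hd h2.deriv ((tsupport_deriv_subset (f := φ)).trans h3)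
  have e2 := h' φ h1 h2 h3
  rw [iteratedDeriv_succ', e1, pow_succ, mul_smul] at e2
  rw [iteratedDeriv_one, pow_one]
  exact smul_right_injective V (pow_ne_zero j (by norm_num : (-1 : ℝ) ≠ 0)) e2

/-- Constant functions, as a continuous linear map. -/
def constCLM : V →L[ℝ] C(Icc a b, V) :=
  LinearMap.mkContinuous
    { toFun := ContinuousMap.const _
      map_add' := fun _ _ => rfl
      map_smul' := fun _ _ => rfl } 1 fun c => by
    rw [one_mul]
    exact (ContinuousMap.norm_le _ (norm_nonneg c)).2 fun _ => le_rfl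

/-- The constant function whose value is the mean of a square integrable function on `[a, b]`. -/
def constMean : L2Space a b V →L[ℝ] C(Icc a b, V) :=
  (b - a)⁻¹ • constCLM.comp
    ((ContinuousMap.evalCLM ℝ (⟨b, right_mem_Icc.2 hab⟩ : Icc a b)).comp primitive)

theorem exists_constMean_eq (u : L2Space a b V) : ∃ c, constMean hab u = constCLM c :=
  ⟨(b - a)⁻¹ • primitive u ⟨b, right_mem_Icc.2 hab⟩, rfl⟩

/-- The continuous representative of a square integrable function `u` on `[a, b]` with square
integrable weak derivative `v`, as a function of the pair `(u, v)`. -/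
def continuousRepr : L2Space a b V × L2Space a b V →L[ℝ] C(Icc a b, V) :=
  ContinuousLinearMap.coprod (constMean hab)
    (primitive - (constMean hab).comp ((continuousToLp hab 2).comp primitive))

/-- No relation between `u` and `v` is needed here: the constant is the mean of `u - primitive v`.
-/
theorem exists_continuousRepr_eq (u v : L2Space a b V) :
    ∃ c, continuousRepr hab (u, v) = constCLM c + primitive v := by
  obtain ⟨c, hc⟩ := exists_constMean_eq hab (u - continuousToLp hab 2 (primitive v))
  refine ⟨c, ?_⟩
  rw [← hc, map_sub]
  simp only [continuousRepr, ContinuousLinearMap.coprod_apply, _root_.sub_apply,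
    ContinuousLinearMap.comp_apply]
  abel

variable [CompleteSpace V] [CompleteSpace W]

/-- The classical case of the weak chain rule: for continuous `v` everything is differentiable, and
integration by parts has no boundary terms because `φ` vanishes at both endpoints. -/
theorem setIntegral_deriv_smul_comp_primitive (hab : a ≤ b) {S : Set V} (hS : IsOpen S) {F : V → W}
    (hF : DifferentiableOn ℝ F S) (hF' : ContinuousOn (fderiv ℝ F) S) (c : V) {v : ℝ → V}
    (hv : Continuous v) (hw : ∀ x ∈ Icc a b, c + (∫ t in a..x, v t) ∈ S) {φ : ℝ → ℝ}
    (hφ : ContDiff ℝ 1 φ) (hφs : tsupport φ ⊆ Ioo a b) :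
    ∫ x in Icc a b, deriv φ x • F (c + ∫ t in a..x, v t) =
      -∫ x in Icc a b, φ x • fderiv ℝ F (c + ∫ t in a..x, v t) (v x) := by
  have hwd : ∀ x, HasDerivAt (fun x => c + ∫ t in a..x, v t) (v x) x := fun x =>
    (intervalIntegral.integral_hasDerivAt_right (hv.intervalIntegrable _ _)
      (hv.stronglyMeasurableAtFilter _ _) hv.continuousAt).const_add c
  have hwc : Continuous fun x => c + ∫ t in a..x, v t :=
    continuous_iff_continuousAt.2 fun x => (hwd x).continuousAt
  have hu : uIcc a b = Icc a b := uIcc_of_le hab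
  have hd : ∀ x ∈ uIcc a b, HasDerivAt (fun x => F (c + ∫ t in a..x, v t))
      (fderiv ℝ F (c + ∫ t in a..x, v t) (v x)) x := by
    intro x hx
    have hx' := hw x (hu ▸ hx)
    exact ((hF _ hx').differentiableAt (hS.mem_nhds hx')).hasFDerivAt.comp_hasDerivAt x (hwd x)
  have h := intervalIntegral.integral_smul_deriv_eq_deriv_smul
    (fun x _ => (hφ.differentiable one_ne_zero x).hasDerivAt) hd
    ((hφ.continuous_deriv le_rfl).intervalIntegrable a b) (by
      refine ContinuousOn.intervalIntegrable ?_
      rw [hu]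
      exact (hF'.comp hwc.continuousOn hw).clm_apply hv.continuousOn)
  rw [eq_zero_of_tsupport_subset_Ioo hφs (fun h => h.2.ne rfl : b ∉ Ioo a b),
    eq_zero_of_tsupport_subset_Ioo hφs (fun h => h.1.ne rfl : a ∉ Ioo a b)] at h
  rw [integral_Icc_eq_integral_Ioc, integral_Icc_eq_integral_Ioc,
    ← intervalIntegral.integral_of_le hab, ← intervalIntegral.integral_of_le hab, h]
  simp

/-- Both sides of the defining identity depend continuously on `v` in the open set of those `v` for
which `c + primitive v` stays in `S`. They agree for continuous `v`, which are dense in $L_2$. -/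
theorem isWeakDeriv_superpose {S : Set V} (hS : IsOpen S) {F : V → W}
    (hF : DifferentiableOn ℝ F S) (hF' : ContinuousOn (fderiv ℝ F) S) (c : V) (v : L2Space a b V)
    (hw : ∀ x, (ContinuousMap.const (Icc a b) c + primitive v) x ∈ S) :
    IsWeakDeriv a b 1 (continuousToLp hab 2 (superpose F (ContinuousMap.const _ c + primitive v)))
      (applyL2 hab (superpose (fderiv ℝ F) (ContinuousMap.const _ c + primitive v)) v) := by
  intro φ hφ _ hφs
  let w : L2Space a b V → C(Icc a b, V) := fun v => ContinuousMap.const _ c + primitive v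
  have hwc : Continuous w := by fun_prop
  let O : Set (L2Space a b V) := w ⁻¹' {u | ∀ x, u x ∈ S}
  have hO : IsOpen O := (isOpen_setOf_forall_mem hS).preimage hwc
  have hφ1 : ContDiff ℝ 1 φ := hφ.of_le (by exact_mod_cast le_top)
  have hφ' : Continuous (iteratedDeriv 1 φ) := hφ1.continuous_iteratedDeriv 1 le_rfl
  let T : L2Space a b V → W := fun v =>
    (∫ x in Icc a b, iteratedDeriv 1 φ x • continuousToLp hab 2 (superpose F (w v)) x) +
      ∫ x in Icc a b, φ x • applyL2 hab (superpose (fderiv ℝ F) (w v)) v x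
  have hT : ContinuousOn T O := by
    refine ContinuousOn.add ?_ ?_
    · refine (continuous_setIntegral_smul hφ').comp_continuousOn
        ((continuousToLp hab 2).continuous.comp_continuousOn ?_)
      exact (continuousOn_superpose hF.continuousOn).comp hwc.continuousOn fun _ h => h
    · refine (continuous_setIntegral_smul hφ.continuous).comp_continuousOn
        (((applyL2 hab).continuous.comp_continuousOn ?_).clm_apply continuousOn_id)
      exact (continuousOn_superpose hF').comp hwc.continuousOn fun _ h => h
  suffices h : T v = 0 by
    rw [pow_one, neg_one_smul]
    exact eq_neg_of_add_eq_zero_left h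
  by_contra hne
  -- If the defect `T` were nonzero at `v`, it would be nonzero on an open set, which contains a
  -- continuous function.
  obtain ⟨_, ⟨hv'O, hv'⟩, v', rfl⟩ :=
    (BoundedContinuousFunction.toLp_denseRange (p := 2) V (volume.restrict (Icc a b)) ℝ
      (by norm_num)).inter_open_nonempty (O ∩ T ⁻¹' {0}ᶜ)
      (hT.isOpen_inter_preimage hO isOpen_compl_singleton) ⟨v, hw, hne⟩
  apply hv'
  set q : L2Space a b V := BoundedContinuousFunction.toLp 2 (volume.restrict (Icc a b)) ℝ v'
  have hq : q =ᵐ[volume.restrict (Icc a b)] v' := BoundedContinuousFunction.coeFn_toLp _ _ ℝ v'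
  have hwq : ∀ x (hx : x ∈ Icc a b), w q ⟨x, hx⟩ = c + ∫ t in a..x, v' t := by
    intro x hx
    have hsub : Ioc a x ⊆ Icc a b := Ioc_subset_Icc_self.trans (Icc_subset_Icc_right hx.2)
    simp only [w, ContinuousMap.add_apply, ContinuousMap.const_apply, primitive_apply]
    rw [intervalIntegral.integral_of_le hx.1]
    congr 1
    exact integral_congr_ae (ae_restrict_of_ae_restrict_of_subset hsub hq)
  have key := setIntegral_deriv_smul_comp_primitive hab hS hF hF' c v'.continuous
    (fun x hx => hwq x hx ▸ hv'O ⟨x, hx⟩) hφ1 hφs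
  have e1 : ∫ x in Icc a b, iteratedDeriv 1 φ x • continuousToLp hab 2 (superpose F (w q)) x =
      ∫ x in Icc a b, deriv φ x • F (c + ∫ t in a..x, v' t) := by
    refine integral_congr_ae ?_
    filter_upwards [coeFn_continuousToLp hab 2 (superpose F (w q)),
      ae_restrict_mem measurableSet_Icc] with x h1 h2
    rw [h1, IccExtend_of_mem hab _ h2, superpose_apply hF.continuousOn hv'O, hwq x h2,
      iteratedDeriv_one]
  have e2 : ∫ x in Icc a b, φ x • applyL2 hab (superpose (fderiv ℝ F) (w q)) q x =
      ∫ x in Icc a b, φ x • fderiv ℝ F (c + ∫ t in a..x, v' t) (v' x) := by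
    refine integral_congr_ae ?_
    filter_upwards [coeFn_applyL2 hab (superpose (fderiv ℝ F) (w q)) q, hq,
      ae_restrict_mem measurableSet_Icc] with x h1 h2 h3
    rw [h1, IccExtend_of_mem hab _ h3, superpose_apply hF' hv'O, hwq x h3, h2]
  show T q = 0
  simp only [T]
  rw [e1, e2, key, neg_add_cancel]

theorem isWeakDeriv_primitive (v : L2Space a b V) :
    IsWeakDeriv a b 1 (continuousToLp hab 2 (primitive v)) v := by
  have hfd : fderiv ℝ (id : V → V) = fun _ => ContinuousLinearMap.id ℝ V :=
    funext fun _ => fderiv_id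
  have hc : ContinuousOn (fderiv ℝ (id : V → V)) univ := hfd ▸ continuousOn_const
  have h := isWeakDeriv_superpose hab (F := id) isOpen_univ differentiableOn_id hc 0 v
    (fun _ => mem_univ _)
  have hu : ContinuousMap.const (Icc a b) (0 : V) + primitive v = primitive v := zero_add _
  have hid : superpose id (primitive v) = primitive v := by
    ext x
    exact superpose_apply continuousOn_id (fun _ => mem_univ _) x
  have hA : superpose (fderiv ℝ (id : V → V)) (primitive v) =
      ContinuousMap.const _ (ContinuousLinearMap.id ℝ V) := by
    ext1 y
    rw [superpose_apply hc (fun _ => mem_univ _), hfd]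
    rfl
  have hv : applyL2 hab (ContinuousMap.const _ (ContinuousLinearMap.id ℝ V)) v = v := by
    ext1
    exact coeFn_applyL2 hab (ContinuousMap.const _ (ContinuousLinearMap.id ℝ V)) v
  rwa [hu, hid, hA, hv] at h

/-- A square integrable function with vanishing weak derivative is constant. -/
theorem ae_eq_const_of_setIntegral_deriv_smul_eq_zero (hab : a < b) {z : ℝ → V}
    (hz : IntegrableOn z (Icc a b))
    (h : ∀ φ : ℝ → ℝ, ContDiff ℝ ∞ φ → HasCompactSupport φ → tsupport φ ⊆ Ioo a b →
      ∫ x in Icc a b, deriv φ x • z x = 0) :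
    ∃ c : V, z =ᵐ[volume.restrict (Icc a b)] fun _ => c := by
  -- A bump of unit mass at the midpoint; outer radius `(b - a) / 4` keeps its support inside the
  -- open interval.
  let f : ContDiffBump ((a + b) / 2) :=
    { rIn := (b - a) / 8, rOut := (b - a) / 4, rIn_pos := by linarith, rIn_lt_rOut := by linarith }
  let ψ : ℝ → ℝ := f.normed volume
  have hψ : ContDiff ℝ ∞ ψ := f.contDiff_normed
  have hψc : HasCompactSupport ψ := f.hasCompactSupport_normed
  have hψs : tsupport ψ ⊆ Ioo a b := by
    rw [f.tsupport_normed_eq, Real.closedBall_eq_Icc]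
    exact Icc_subset_Ioo (by simp only [f]; linarith) (by simp only [f]; linarith)
  have hψi : ∫ x, ψ x = 1 := f.integral_normed
  have hsm : ∀ {g : ℝ → ℝ}, Continuous g → IntegrableOn (fun x => g x • z x) (Icc a b) :=
    fun hg => hz.continuousOn_smul hg.continuousOn isCompact_Icc
  -- A test function with integral zero is the derivative of a test function, namely of its own
  -- primitive.
  have key : ∀ g : ℝ → ℝ, ContDiff ℝ ∞ g → HasCompactSupport g → tsupport g ⊆ Ioo a b →
      ∫ x, g x = 0 → ∫ x in Icc a b, g x • z x = 0 := by
    intro g hg hgc hgs hgi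
    have hd : ∀ x, HasDerivAt (fun x => ∫ t in a..x, g t) (g x) x := fun x =>
      intervalIntegral.integral_hasDerivAt_right (hg.continuous.intervalIntegrable _ _)
        (hg.continuous.stronglyMeasurableAtFilter _ _) hg.continuous.continuousAt
    have hderiv : deriv (fun x => ∫ t in a..x, g t) = g := funext fun x => (hd x).deriv
    obtain ⟨α, β, hα, hβ, hαβ⟩ : ∃ α β, a < α ∧ β < b ∧ tsupport g ⊆ Icc α β := by
      rcases (tsupport g).eq_empty_or_nonempty with he | hne
      -- For empty support any bounds will do; `α ≤ β` is never required.
      · exact ⟨a + 1, b - 1, by linarith, by linarith, by simp [he]⟩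
      · obtain ⟨α, hα⟩ := hgc.isCompact.exists_isLeast hne
        obtain ⟨β, hβ⟩ := hgc.isCompact.exists_isGreatest hne
        exact ⟨α, β, (hgs hα.1).1, (hgs hβ.1).2, fun x hx => ⟨hα.2 hx, hβ.2 hx⟩⟩
    have hg0 : ∀ x, x ∉ Icc α β → g x = 0 := fun x hx =>
      image_eq_zero_of_notMem_tsupport fun h' => hx (hαβ h')
    have hsupp : tsupport (fun x => ∫ t in a..x, g t) ⊆ Icc α β := by
      refine closure_minimal (fun x hx => ?_) isClosed_Icc
      by_contra hx'
      apply hx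
      rcases lt_or_ge x α with h1 | h1
      · refine intervalIntegral.integral_zero_ae (ae_of_all _ fun t ht => hg0 t fun ht' => ?_)
        have := ht.2.trans_lt (max_lt hα h1)
        exact absurd ht'.1 (not_le.2 this)
      · have h2 : β < x := not_le.1 fun h2 => hx' ⟨h1, h2⟩
        show ∫ t in a..x, g t = 0
        rw [intervalIntegral.integral_eq_integral_of_support_subset, hgi]
        intro t ht
        have ht' : t ∈ Icc α β := by
          by_contra h3
          exact ht (hg0 t h3)
        exact ⟨hα.trans_le ht'.1, ht'.2.trans h2.le⟩
    have := h (fun x => ∫ t in a..x, g t)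
      (contDiff_infty_iff_deriv.2 ⟨fun x => (hd x).differentiableAt, by rw [hderiv]; exact hg⟩)
      (HasCompactSupport.of_support_subset_isCompact isCompact_Icc
        ((subset_tsupport _).trans hsupp)) (hsupp.trans (Icc_subset_Ioo hα hβ))
    rwa [hderiv] at this
  let c : V := ∫ x in Icc a b, ψ x • z x
  refine ⟨c, ?_⟩
  have hzc : IntegrableOn (fun x => z x - c) (Icc a b) := hz.sub (by simp)
  have hae : ∀ᵐ x, x ∈ Ioo a b → z x - c = 0 := by
    refine isOpen_Ioo.ae_eq_zero_of_integral_contDiff_smul_eq_zero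
      (hzc.mono_set Ioo_subset_Icc_self).locallyIntegrableOn fun g hg hgc hgs => ?_
    have hgI : ∫ x in Icc a b, g x = ∫ x, g x :=
      setIntegral_eq_integral_of_forall_compl_eq_zero fun x hx =>
        eq_zero_of_tsupport_subset_Ioo hgs fun h' => hx (Ioo_subset_Icc_self h')
    rw [← setIntegral_eq_integral_of_forall_compl_eq_zero (s := Icc a b) fun x hx => by
      rw [eq_zero_of_tsupport_subset_Ioo hgs fun h' => hx (Ioo_subset_Icc_self h'), zero_smul]]
    have hint : ∀ {g : ℝ → ℝ}, ContDiff ℝ ∞ g → HasCompactSupport g → Integrable g :=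
      fun hg hgc => hg.continuous.integrable_of_hasCompactSupport hgc
    set I := ∫ x, g x
    -- Subtracting `I * ψ` gives integral zero, so `key` applies and the integral of `g • z` equals
    -- `I • c`.
    have hs : tsupport (fun x => g x - I * ψ x) ⊆ Ioo a b :=
      (tsupport_sub g fun x => I * ψ x).trans
        (union_subset hgs ((tsupport_mul_subset_right).trans hψs))
    have h1 := key (fun x => g x - I * ψ x) (hg.sub (contDiff_const.mul hψ))
      (hgc.sub hψc.mul_left) hs (by
        rw [integral_sub (hint hg hgc) ((hint hψ hψc).const_mul I), integral_const_mul, hψi]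
        simp [I])
    simp only [sub_smul, mul_smul] at h1
    have hI : IntegrableOn (fun x => I • ψ x • z x) (Icc a b) := (hsm hψ.continuous).smul I
    rw [integral_sub (hsm hg.continuous) hI, integral_smul] at h1
    simp only [smul_sub]
    rw [integral_sub (hsm hg.continuous) ((hint hg hgc).integrableOn.smul_const c),
      integral_smul_const, hgI]
    exact h1
  rw [Filter.EventuallyEq, ← restrict_Ioo_eq_restrict_Icc, ae_restrict_iff' measurableSet_Ioo]
  filter_upwards [hae] with x hx hx'
  exact sub_eq_zero.1 (hx hx')

theorem constMean_of_ae_eq_const (hab : a < b) {u : L2Space a b V} {c : V}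
    (h : u =ᵐ[volume.restrict (Icc a b)] fun _ => c) : constMean hab.le u = constCLM c := by
  have : primitive u ⟨b, right_mem_Icc.2 hab.le⟩ = (b - a) • c := by
    rw [primitive_apply, ← integral_Icc_eq_integral_Ioc, integral_congr_ae h]
    simp [hab.le, Measure.real]
  change constCLM ((b - a)⁻¹ • primitive u ⟨b, right_mem_Icc.2 hab.le⟩) = _
  rw [this, smul_smul, inv_mul_cancel₀ (sub_pos.2 hab).ne', one_smul]

/-- Since `u` and `primitive v` have the same weak derivative, they differ by a constant, which
`constMean` recovers. -/
theorem continuousToLp_continuousRepr (hab : a < b) {u v : L2Space a b V}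
    (h : IsWeakDeriv a b 1 u v) : continuousToLp hab.le 2 (continuousRepr hab.le (u, v)) = u := by
  set z : L2Space a b V := u - continuousToLp hab.le 2 (primitive v) with hz
  obtain ⟨c, hc⟩ := ae_eq_const_of_setIntegral_deriv_smul_eq_zero hab (L2Space.integrableOn z)
    fun φ h1 h2 h3 => by
      have e1 := h φ h1 h2 h3
      have e2 := isWeakDeriv_primitive hab.le v φ h1 h2 h3
      have hd : Continuous (deriv φ) := h1.continuous_deriv (by exact_mod_cast le_top)
      rw [iteratedDeriv_one] at e1 e2
      have : ∫ x in Icc a b, deriv φ x • z x = (∫ x in Icc a b, deriv φ x • u x) -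
          ∫ x in Icc a b, deriv φ x • continuousToLp hab.le 2 (primitive v) x := by
        rw [← integral_sub (integrable_smul_of_contDiff hd _) (integrable_smul_of_contDiff hd _)]
        refine integral_congr_ae ?_
        filter_upwards [Lp.coeFn_sub u (continuousToLp hab.le 2 (primitive v))] with x hx
        rw [hz, hx, Pi.sub_apply, smul_sub]
      rw [this, e1, e2, sub_self]
  have hr : continuousRepr hab.le (u, v) = constCLM c + primitive v := by
    rw [← constMean_of_ae_eq_const hab hc, hz, map_sub]
    simp only [continuousRepr, ContinuousLinearMap.coprod_apply, _root_.sub_apply,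
      ContinuousLinearMap.comp_apply]
    abel
  have hcz : continuousToLp hab.le 2 (constCLM c) = z := by
    ext1
    filter_upwards [coeFn_continuousToLp hab.le 2 (constCLM c), hc] with x h1 h2
    rw [h1, h2]
    rfl
  rw [hr, map_add, hcz, hz, sub_add_cancel]

theorem primitive_compLpL (L : V →L[ℝ] W) (v : L2Space a b V) :
    primitive (L.compLpL 2 (volume.restrict (Icc a b)) v) =
      L.compLeftContinuous ℝ (Icc a b) (primitive v) := by
  ext x
  have hx : Ioc a (x : ℝ) ⊆ Icc a b := Ioc_subset_Icc_self.trans (Icc_subset_Icc_right x.2.2)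
  change _ = L (primitive v x)
  rw [primitive_apply, primitive_apply,
    ← L.integral_comp_comm ((L2Space.integrableOn v).mono_set hx)]
  exact integral_congr_ae (ae_restrict_of_ae_restrict_of_subset hx (L.coeFn_compLpL v))

end IntervalSpaces

/-! ### Total derivatives on jets -/

section TotalDerivative

variable {E : Type} [NormedAddCommGroup E]

/-- The jets of order `j` of norm less than `R` with base point in `G`. -/
def jetDomain (G : Set E) (R : ℝ) (j : ℕ) : Set (Fin (j + 1) → E) :=
  {y | y 0 ∈ G ∧ ‖y‖ < R}

theorem isOpen_jetDomain {G : Set E} (hG : IsOpen G) (R : ℝ) (j : ℕ) :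
    IsOpen (jetDomain G R j) :=
  (hG.preimage (continuous_apply 0)).inter (isOpen_lt continuous_norm continuous_const)

theorem isBounded_jetDomain (G : Set E) (R : ℝ) (j : ℕ) :
    Bornology.IsBounded (jetDomain G R j) :=
  isBounded_iff_forall_norm_le.2 ⟨R, fun _ hy => hy.2.le⟩

variable {Y : Type} [NormedSpace ℝ E] [NormedAddCommGroup Y] [NormedSpace ℝ Y]

/-- The function `F` with `(f ∘ u)^(j) = F (u, u', …, u^(j))` for smooth functions `u` of a real
variable. -/
def totalDeriv (f : E → Y) : (j : ℕ) → (Fin (j + 1) → E) → Y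
  | 0 => fun y => f (y 0)
  | j + 1 => fun y => fderiv ℝ (totalDeriv f j) (Fin.init y) (Fin.tail y)

/-- The jet without its last entry. -/
def jetInit (j : ℕ) : (Fin (j + 2) → E) →L[ℝ] (Fin (j + 1) → E) :=
  ContinuousLinearMap.pi fun i => ContinuousLinearMap.proj (R := ℝ) (φ := fun _ : Fin (j + 2) => E) (Fin.castSucc i)

/-- The jet without its first entry. -/
def jetTail (j : ℕ) : (Fin (j + 2) → E) →L[ℝ] (Fin (j + 1) → E) :=
  ContinuousLinearMap.pi fun i => ContinuousLinearMap.proj (R := ℝ) (φ := fun _ : Fin (j + 2) => E) (Fin.succ i)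

theorem mapsTo_jetInit (G : Set E) (R : ℝ) (j : ℕ) :
    MapsTo (jetInit j) (jetDomain G R (j + 1)) (jetDomain G R j) := fun y hy =>
  ⟨hy.1, ((pi_norm_le_iff_of_nonneg (norm_nonneg y)).2
    fun i : Fin (j + 1) => norm_le_pi_norm y i.castSucc).trans_lt hy.2⟩

/-- Each total derivative costs one order of smoothness. The factor `jetTail` is linear, hence
$C_b^n$ only because the jets are bounded by `R`. -/
theorem isCb_totalDeriv {G : Set E} (hG : IsOpen G) (R : ℝ) {f : E → Y} {n j : ℕ}
    (hf : IsCb (n + j) f G) : IsCb n (totalDeriv f j) (jetDomain G R j) := by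
  induction j generalizing n with
  | zero =>
    exact hf.comp_clm hG (ContinuousLinearMap.proj (R := ℝ) (φ := fun _ : Fin 1 => E) 0)
      (isOpen_jetDomain hG R 0) fun _ hy => hy.1
  | succ j ih =>
    have h1 : IsCb (n + 1) (totalDeriv f j) (jetDomain G R j) :=
      ih (by rwa [Nat.add_right_comm, Nat.add_assoc])
    have h2 := ((isCb_succ_iff (isOpen_jetDomain hG R j)).1 h1).2.2
    have hO := isOpen_jetDomain hG R (j + 1)
    exact (h2.comp_clm (isOpen_jetDomain hG R j) (jetInit j) hO (mapsTo_jetInit G R j)).bilinear hO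
      (ContinuousLinearMap.id ℝ _) (IsCb.clm (jetTail j) hO (isBounded_jetDomain G R (j + 1)))

end TotalDerivative

/-! ### Closedness of the Sobolev space and the projection onto it -/

section ClosedSubspace

variable {a b : ℝ} {l m : ℕ}

theorem isClosed_sobolevSubmodule {E : Type} [NormedAddCommGroup E] [NormedSpace ℝ E] :
    IsClosed (sobolevSubmodule a b l E : Set (PiLp 2 fun _ : Fin (l + 1) => L2Space a b E)) := by
  change IsClosed {U : PiLp 2 fun _ : Fin (l + 1) => L2Space a b E |
    ∀ j : Fin (l + 1), IsWeakDeriv a b j (U 0) (U j)}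
  simp only [IsWeakDeriv, ofPred_forall]
  refine isClosed_iInter fun j => isClosed_iInter fun φ => isClosed_iInter fun h1 =>
    isClosed_iInter fun h2 => isClosed_iInter fun h3 => ?_
  have hp : ∀ i : Fin (l + 1), Continuous fun U : PiLp 2 fun _ : Fin (l + 1) => L2Space a b E =>
      U i := fun i => PiLp.continuous_apply 2 _ i
  refine isClosed_eq ?_ ?_
  · exact (continuous_setIntegral_smul (h1.continuous_iteratedDeriv _
      (by exact_mod_cast le_top))).comp (hp 0)
  · exact ((continuous_setIntegral_smul h1.continuous).comp (hp j)).const_smul _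

/-- Composition with `P` makes a $C_b^k$ map into the product a $C_b^k$ map into the Sobolev space,
without changing values that already lie there. -/
theorem exists_projection_sobolev :
    ∃ P : (PiLp 2 fun _ : Fin (l + 1) => L2Space a b (EuclideanSpace ℝ (Fin m))) →L[ℝ]
      Sobolev a b l m, ∀ U : Sobolev a b l m, P U.1 = U := by
  have : CompleteSpace (sobolevSubmodule a b l (EuclideanSpace ℝ (Fin m))) :=
    isClosed_sobolevSubmodule.completeSpace_coe
  exact ⟨(sobolevSubmodule a b l (EuclideanSpace ℝ (Fin m))).orthogonalProjectionOnto,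
    fun U => Submodule.orthogonalProjectionOnto_mem_subspace_eq_self U⟩

end ClosedSubspace

/-! ### Superposition into $L_2$ -/

section SuperposeL2

variable {a b : ℝ} (hab : a ≤ b) {X E Y : Type} [NormedAddCommGroup X] [NormedSpace ℝ X]
  [NormedAddCommGroup E] [NormedSpace ℝ E] [NormedAddCommGroup Y] [NormedSpace ℝ Y]

theorem IsCb.superpose_comp {n : ℕ} {f : E → Y} {S : Set E} (hS : IsOpen S) (hf : IsCb n f S)
    (L : X →L[ℝ] C(Icc a b, E)) {U : Set X} (hU : IsOpen U) (hUS : ∀ u ∈ U, ∀ x, L u x ∈ S) :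
    IsCb n (fun u => _root_.superpose f (L u)) U :=
  (hf.superpose hS).comp_clm (isOpen_setOf_forall_mem hS) L hU hUS

theorem iteratedFDeriv_continuousToLp_superpose {n : ℕ} {f : E → Y} {S : Set E} (hS : IsOpen S)
    (hf : IsCb n f S) (L : X →L[ℝ] C(Icc a b, E)) {u : X} (hu : ∀ x, L u x ∈ S)
    (h : Fin n → X) :
    iteratedFDeriv ℝ n (fun u => continuousToLp hab 2 (superpose f (L u))) u h
      =ᵐ[volume.restrict (Icc a b)]
      fun x => iteratedFDeriv ℝ n f (IccExtend hab (L u) x) fun i => IccExtend hab (L (h i)) x := by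
  have hO := isOpen_setOf_forall_mem (K := Icc a b) hS
  have hO' := hO.preimage L.continuous
  have hc : ContDiffAt ℝ n (superpose f ∘ L) u :=
    (hf.superpose_comp hS L hO' fun _ h => h).contDiffOn.contDiffAt (hO'.mem_nhds hu)
  have h1 : iteratedFDeriv ℝ n (fun u => continuousToLp hab 2 (superpose f (L u))) u h =
      continuousToLp hab 2 (iteratedFDeriv ℝ n (superpose f) (L u) fun i => L (h i)) := by
    have e := ContinuousLinearMap.iteratedFDeriv_comp_left (continuousToLp hab 2) hc le_rfl
    have e' := L.iteratedFDerivWithin_comp_right (hf.superpose hS).contDiffOn hO.uniqueDiffOn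
      hO'.uniqueDiffOn hu le_rfl
    rw [iteratedFDerivWithin_of_isOpen n hO' hu, iteratedFDerivWithin_of_isOpen n hO hu] at e'
    rw [e'] at e
    exact congrArg (fun A => A h) e
  rw [h1]
  filter_upwards [coeFn_continuousToLp hab 2
    (iteratedFDeriv ℝ n (superpose f) (L u) fun i => L (h i))] with x hx
  rw [hx]
  exact iteratedFDeriv_superpose_apply hS hf hu _ _

end SuperposeL2

/-! ### Jets of Sobolev functions and the weak derivatives of the superposition -/

section SobolevJets

variable {a b : ℝ} {l d m : ℕ}

/-- The weak derivative of order `i` of an element of a Sobolev space. -/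
def sobolevDeriv (i : Fin (l + 1)) :
    Sobolev a b l d →L[ℝ] L2Space a b (EuclideanSpace ℝ (Fin d)) :=
  (PiLp.proj 2 (fun _ : Fin (l + 1) => L2Space a b (EuclideanSpace ℝ (Fin d))) i).comp
    (sobolevSubmodule a b l (EuclideanSpace ℝ (Fin d))).subtypeL

theorem isWeakDeriv_sobolevDeriv (u : Sobolev a b l d) (i : Fin (l + 1)) :
    IsWeakDeriv a b i (sobolevDeriv 0 u) (sobolevDeriv i u) := u.2 i

variable (hab : a < b)

/-- The continuous representative of the weak derivative of order `i < l` of an element of the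
Sobolev space of order `l`. -/
def sobolevCont (i : Fin l) :
    Sobolev a b l d →L[ℝ] C(Icc a b, EuclideanSpace ℝ (Fin d)) :=
  (continuousRepr hab.le).comp ((sobolevDeriv i.castSucc).prod (sobolevDeriv i.succ))

theorem continuousToLp_sobolevCont (i : Fin l) (u : Sobolev a b l d) :
    continuousToLp hab.le 2 (sobolevCont hab i u) = sobolevDeriv i.castSucc u :=
  continuousToLp_continuousRepr hab
    ((isWeakDeriv_sobolevDeriv u i.castSucc).of_succ (isWeakDeriv_sobolevDeriv u i.succ))

theorem sobolevDeriv_castSucc_ae_eq (i : Fin l) (u : Sobolev a b l d) :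
    sobolevDeriv i.castSucc u =ᵐ[volume.restrict (Icc a b)]
      IccExtend hab.le (sobolevCont hab i u) := by
  rw [← continuousToLp_sobolevCont hab]
  exact coeFn_continuousToLp hab.le 2 _

/-- The continuous function `(u, u', …, u^(j))` for `u` in the Sobolev space of order `l > j`. -/
def sobolevJet (j : Fin l) :
    Sobolev a b l d →L[ℝ] C(Icc a b, Fin (j + 1) → EuclideanSpace ℝ (Fin d)) :=
  ∑ i : Fin (j + 1),
    ((ContinuousLinearMap.single ℝ (fun _ => EuclideanSpace ℝ (Fin d)) i).compLeftContinuous ℝ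
      (Icc a b)).comp (sobolevCont hab (Fin.castLE j.2 i))

/-- The square integrable function `(u', …, u^(j+1))` for `u` in the Sobolev space of order
`l > j`. -/
def sobolevJetDeriv (j : Fin l) :
    Sobolev a b l d →L[ℝ] L2Space a b (Fin (j + 1) → EuclideanSpace ℝ (Fin d)) :=
  ∑ i : Fin (j + 1),
    ((ContinuousLinearMap.single ℝ (fun _ => EuclideanSpace ℝ (Fin d)) i).compLpL 2
      (volume.restrict (Icc a b))).comp (sobolevDeriv (Fin.castLE j.2 i).succ)

theorem sobolevJet_apply (j : Fin l) (u : Sobolev a b l d) (x : Icc a b) :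
    sobolevJet hab j u x = fun i => sobolevCont hab (Fin.castLE j.2 i) u x := by
  have : sobolevJet hab j u x = ∑ i : Fin (j + 1),
      ContinuousLinearMap.single ℝ (fun _ => EuclideanSpace ℝ (Fin d)) i
        (sobolevCont hab (Fin.castLE j.2 i) u x) := by
    simp only [sobolevJet, _root_.sum_apply, ContinuousMap.sum_apply]
    rfl
  rw [this]
  ext1 i
  simp [Finset.sum_apply]

theorem coeFn_sobolevJetDeriv (j : Fin l) (u : Sobolev a b l d) :
    sobolevJetDeriv j u =ᵐ[volume.restrict (Icc a b)]
      fun x i => sobolevDeriv (Fin.castLE j.2 i).succ u x := by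
  let A : Fin (j + 1) → L2Space a b (Fin (j + 1) → EuclideanSpace ℝ (Fin d)) := fun i =>
    (ContinuousLinearMap.single ℝ (fun _ => EuclideanSpace ℝ (Fin d)) i).compLpL 2
      (volume.restrict (Icc a b)) (sobolevDeriv (Fin.castLE j.2 i).succ u)
  have hA : sobolevJetDeriv j u = ∑ i, A i := by
    simp only [sobolevJetDeriv, _root_.sum_apply]
    rfl
  have hAi : ∀ᵐ x ∂volume.restrict (Icc a b), ∀ i, A i x =
      ContinuousLinearMap.single ℝ (fun _ => EuclideanSpace ℝ (Fin d)) i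
        (sobolevDeriv (Fin.castLE j.2 i).succ u x) :=
    ae_all_iff.2 fun i => ContinuousLinearMap.coeFn_compLpL _ _
  rw [hA]
  filter_upwards [Lp.coeFn_finsetSum Finset.univ A, hAi] with x h1 h2
  rw [h1]
  ext1 i
  simp [Finset.sum_apply, h2]

/-- This is the form, constant plus primitive, in which the weak chain rule applies to jets. -/
theorem exists_sobolevJet_eq (j : Fin l) (u : Sobolev a b l d) :
    ∃ c, sobolevJet hab j u = ContinuousMap.const _ c + primitive (sobolevJetDeriv j u) := by
  choose c hc using fun i : Fin l =>
    exists_continuousRepr_eq hab.le (sobolevDeriv i.castSucc u) (sobolevDeriv i.succ u)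
  refine ⟨∑ i : Fin (j + 1), ContinuousLinearMap.single ℝ (fun _ => EuclideanSpace ℝ (Fin d)) i
    (c (Fin.castLE j.2 i)), ?_⟩
  simp only [sobolevJet, sobolevJetDeriv, _root_.sum_apply, map_sum,
    ContinuousLinearMap.comp_apply, primitive_compLpL]
  have hconst : ∀ (ι : Type) [Fintype ι] (g : ι → Fin (j + 1) → EuclideanSpace ℝ (Fin d)),
      ContinuousMap.const (Icc a b) (∑ i, g i) = ∑ i, ContinuousMap.const (Icc a b) (g i) := by
    intro ι _ g
    exact map_sum constCLM g Finset.univ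
  rw [hconst, ← Finset.sum_add_distrib]
  refine Finset.sum_congr rfl fun i _ => ?_
  change ContinuousLinearMap.compLeftContinuous ℝ _ _
    (continuousRepr hab.le (sobolevDeriv _ u, sobolevDeriv _ u)) = _
  rw [hc, map_add]
  rfl

theorem sobolevJet_init {j : ℕ} (hj : j + 1 < l) (u : Sobolev a b l d) (x : Icc a b) :
    jetInit j (sobolevJet hab ⟨j + 1, hj⟩ u x) =
      sobolevJet hab ⟨j, (Nat.lt_succ_self j).trans hj⟩ u x := by
  rw [sobolevJet_apply, sobolevJet_apply]
  rfl

theorem sobolevJetDeriv_ae_eq_tail {j : ℕ} (hj : j + 1 < l) (u : Sobolev a b l d) :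
    sobolevJetDeriv ⟨j, (Nat.lt_succ_self j).trans hj⟩ u =ᵐ[volume.restrict (Icc a b)]
      fun x => jetTail j (IccExtend hab.le (sobolevJet hab ⟨j + 1, hj⟩ u) x) := by
  have h : ∀ᵐ x ∂volume.restrict (Icc a b), ∀ i : Fin l,
      sobolevDeriv i.castSucc u x = IccExtend hab.le (sobolevCont hab i u) x :=
    ae_all_iff.2 fun i => sobolevDeriv_castSucc_ae_eq hab i u
  filter_upwards [coeFn_sobolevJetDeriv ⟨j, (Nat.lt_succ_self j).trans hj⟩ u, h] with x h1 h2
  rw [h1]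
  ext1 i
  have := h2 (Fin.castLE hj i.succ)
  simp only [IccExtend, Function.comp_apply] at this ⊢
  rw [sobolevJet_apply]
  exact this

/-- The weak derivatives of `f ∘ u`. -/
def superposeDeriv (f : EuclideanSpace ℝ (Fin d) → EuclideanSpace ℝ (Fin m)) (hl : 0 < l)
    (u : Sobolev a b l d) : Fin (l + 1) → L2Space a b (EuclideanSpace ℝ (Fin m)) :=
  Fin.cases (continuousToLp hab.le 2 (superpose f (sobolevCont hab ⟨0, hl⟩ u))) fun j =>
    applyL2 hab.le (superpose (fderiv ℝ (totalDeriv f j)) (sobolevJet hab j u))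
      (sobolevJetDeriv j u)

variable {G : Set (EuclideanSpace ℝ (Fin d))} {R : ℝ} {N : ℕ}
  {f : EuclideanSpace ℝ (Fin d) → EuclideanSpace ℝ (Fin m)}

/-- Below the top order all entries of the jet are continuous, so the bilinear expression is itself
a superposition. In this form it can be differentiated once more by the weak chain rule. -/
theorem superposeDeriv_castSucc (hG : IsOpen G) (hf : IsCb N f G) (hl : 0 < l) (hlN : l ≤ N)
    {u : Sobolev a b l d} (hu : ∀ (j : Fin l) x, sobolevJet hab j u x ∈ jetDomain G R j) (j : Fin l) :
    superposeDeriv hab f hl u j.castSucc =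
      continuousToLp hab.le 2 (superpose (totalDeriv f j) (sobolevJet hab j u)) := by
  have hF : ∀ j : ℕ, j < l → IsCb 1 (totalDeriv f j) (jetDomain G R j) := fun j hj =>
    isCb_totalDeriv hG R (hf.mono_order (by omega))
  obtain ⟨j, hj⟩ := j
  cases j with
  | zero =>
    change continuousToLp hab.le 2 (superpose f (sobolevCont hab ⟨0, hl⟩ u)) = _
    congr 1
    ext1 x
    rw [superpose_apply (hF 0 hl).extendsBounded.continuousOn (hu ⟨0, hl⟩),
      superpose_apply hf.extendsBounded.continuousOn fun x => ?_, sobolevJet_apply]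
    · rfl
    · have := (hu ⟨0, hl⟩ x).1
      rwa [sobolevJet_apply] at this
  | succ j =>
    have hj' : j < l := by omega
    change applyL2 hab.le (superpose (fderiv ℝ (totalDeriv f j)) (sobolevJet hab ⟨j, hj'⟩ u))
      (sobolevJetDeriv ⟨j, hj'⟩ u) = _
    have hF' := ((isCb_succ_iff (isOpen_jetDomain hG R j)).1 (hF j hj')).2.2
    ext1
    filter_upwards [coeFn_applyL2 hab.le
        (superpose (fderiv ℝ (totalDeriv f j)) (sobolevJet hab ⟨j, hj'⟩ u))
        (sobolevJetDeriv ⟨j, hj'⟩ u), sobolevJetDeriv_ae_eq_tail hab hj u,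
      coeFn_continuousToLp hab.le 2 (superpose (totalDeriv f (j + 1))
        (sobolevJet hab ⟨j + 1, hj⟩ u))] with x h1 h2 h3
    rw [h1, h2, h3]
    simp only [IccExtend, Function.comp_apply]
    rw [superpose_apply hF'.extendsBounded.continuousOn (hu ⟨j, hj'⟩),
      superpose_apply (hF (j + 1) hj).extendsBounded.continuousOn (hu ⟨j + 1, hj⟩),
      ← sobolevJet_init hab hj]
    rfl

theorem isWeakDeriv_superposeDeriv (hG : IsOpen G) (hf : IsCb N f G) (hl : 0 < l) (hlN : l ≤ N)
    {u : Sobolev a b l d} (hu : ∀ (j : Fin l) x, sobolevJet hab j u x ∈ jetDomain G R j)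
    (i : Fin (l + 1)) :
    IsWeakDeriv a b i (superposeDeriv hab f hl u 0) (superposeDeriv hab f hl u i) := by
  induction i using Fin.induction with
  | zero => intro φ _ _ _; simp
  | succ j ih =>
    refine ih.succ ?_
    rw [superposeDeriv_castSucc hab hG hf hl hlN hu]
    have hF := (isCb_succ_iff (isOpen_jetDomain hG R j)).1
      (isCb_totalDeriv hG R (n := 1) (j := j) (hf.mono_order (by omega)))
    obtain ⟨c, hc⟩ := exists_sobolevJet_eq hab j u
    have := isWeakDeriv_superpose hab.le (isOpen_jetDomain hG R j) hF.2.1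
      hF.2.2.extendsBounded.continuousOn c (sobolevJetDeriv j u) (fun x => hc ▸ hu j x)
    rwa [← hc] at this

theorem isCb_superposeDeriv (hG : IsOpen G) (hf : IsCb N f G) (hl : 0 < l) {k : ℕ}
    (hk : k + l ≤ N) {U : Set (Sobolev a b l d)} (hU : IsOpen U) (hUb : Bornology.IsBounded U)
    (hu : ∀ u ∈ U, ∀ (j : Fin l) x, sobolevJet hab j u x ∈ jetDomain G R j) (i : Fin (l + 1)) :
    IsCb k (fun u => superposeDeriv hab f hl u i) U := by
  cases i using Fin.cases with
  | zero =>
    refine ((hf.mono_order (by omega : k ≤ N)).superpose_comp hG (sobolevCont hab ⟨0, hl⟩) hU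
      fun u hu' x => ?_).clm_comp hU (continuousToLp hab.le 2)
    have := (hu u hu' ⟨0, hl⟩ x).1
    rwa [sobolevJet_apply] at this
  | succ j =>
    have hO := isOpen_jetDomain hG R (j : ℕ)
    -- Here `j + 1 ≤ l` gives `k + 1 + j ≤ N`, which leaves order `k` for the derivative of
    -- `totalDeriv f j`.
    have hF := ((isCb_succ_iff hO).1
      (isCb_totalDeriv hG R (n := k + 1) (j := j) (hf.mono_order (by omega)))).2.2
    exact (hF.superpose_comp hO (sobolevJet hab j) hU fun u hu' => hu u hu' j).bilinear hU
      (applyL2 hab.le) (IsCb.clm (sobolevJetDeriv j) hU hUb)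

/-- Two continuous representatives agree almost everywhere, hence everywhere on a nondegenerate
interval. -/
theorem sobolevCont_mem_of_mem_continuousInto (hl : 0 < l) {u : Sobolev a b l d}
    (hu : u ∈ Sobolev.continuousInto a b l G) (x : Icc a b) : sobolevCont hab ⟨0, hl⟩ u x ∈ G := by
  obtain ⟨v, hv, huv, hvG⟩ := hu
  have h1 := (sobolevDeriv_castSucc_ae_eq hab ⟨0, hl⟩ u).symm.trans huv
  have h2 := Measure.eqOn_Icc_of_ae_eq volume hab.ne h1
    ((sobolevCont hab ⟨0, hl⟩ u).continuous.Icc_extend' (h := hab.le)).continuousOn hv x.2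
  rw [IccExtend_of_mem hab.le _ x.2] at h2
  exact h2 ▸ hvG x x.2

theorem exists_sobolevJet_mem_jetDomain (hl : 0 < l) {U : Set (Sobolev a b l d)}
    (hUb : Bornology.IsBounded U) (hUG : U ⊆ Sobolev.continuousInto a b l G) :
    ∃ R, ∀ u ∈ U, ∀ (j : Fin l) x, sobolevJet hab j u x ∈ jetDomain G R j := by
  obtain ⟨C, hC⟩ := hUb.exists_norm_le
  -- The sum dominates the bound for each single `j`; the summand `1` makes the inequality strict.
  refine ⟨1 + ∑ j : Fin l, ‖(sobolevJet hab j : Sobolev a b l d →L[ℝ] _)‖ * |C|,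
    fun u hu j x => ⟨?_, ?_⟩⟩
  · rw [sobolevJet_apply]
    exact sobolevCont_mem_of_mem_continuousInto hab hl (hUG hu) x
  · have h1 : ‖sobolevJet hab j u x‖ ≤ ‖(sobolevJet hab j : Sobolev a b l d →L[ℝ] _)‖ * |C| :=
      ((sobolevJet hab j u).norm_coe_le_norm x).trans
        ((sobolevJet hab j).le_opNorm_of_le ((hC u hu).trans (le_abs_self C)))
    have h2 := Finset.single_le_sum
      (f := fun j : Fin l => ‖(sobolevJet hab j : Sobolev a b l d →L[ℝ] _)‖ * |C|)
      (fun _ _ => by positivity) (Finset.mem_univ j)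
    linarith

theorem toL2_ae_eq_sobolevCont (hl : 0 < l) (u : Sobolev a b l d) :
    u.toL2 =ᵐ[volume.restrict (Icc a b)] IccExtend hab.le (sobolevCont hab ⟨0, hl⟩ u) :=
  sobolevDeriv_castSucc_ae_eq hab ⟨0, hl⟩ u

theorem continuousToLp_superpose_ae_eq (hf : ContinuousOn f G) (hl : 0 < l) {u : Sobolev a b l d}
    (hu : ∀ x, sobolevCont hab ⟨0, hl⟩ u x ∈ G) :
    continuousToLp hab.le 2 (superpose f (sobolevCont hab ⟨0, hl⟩ u))
      =ᵐ[volume.restrict (Icc a b)] fun x => f (u.toL2 x) := by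
  filter_upwards [coeFn_continuousToLp hab.le 2 (superpose f (sobolevCont hab ⟨0, hl⟩ u)),
    toL2_ae_eq_sobolevCont hab hl u] with x h1 h2
  rw [h1, h2]
  exact superpose_apply hf hu _

theorem iteratedFDeriv_superpose_sobolevCont_ae_eq (hG : IsOpen G) {j : ℕ} (hf : IsCb j f G)
    (hl : 0 < l) {u : Sobolev a b l d} (hu : ∀ x, sobolevCont hab ⟨0, hl⟩ u x ∈ G)
    (h : Fin j → Sobolev a b l d) :
    iteratedFDeriv ℝ j
        (fun u => continuousToLp hab.le 2 (superpose f (sobolevCont hab ⟨0, hl⟩ u))) u h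
      =ᵐ[volume.restrict (Icc a b)]
      fun x => iteratedFDeriv ℝ j f (u.toL2 x) fun i => (h i).toL2 x := by
  have hh : ∀ᵐ x ∂volume.restrict (Icc a b), ∀ i, (h i).toL2 x =
      IccExtend hab.le (sobolevCont hab ⟨0, hl⟩ (h i)) x :=
    ae_all_iff.2 fun i => toL2_ae_eq_sobolevCont hab hl (h i)
  filter_upwards [iteratedFDeriv_continuousToLp_superpose hab.le hG hf
    (sobolevCont hab ⟨0, hl⟩) hu h, toL2_ae_eq_sobolevCont hab hl u, hh] with x h1 h2 h3
  rw [h1, h2]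
  simp only [h3]

end SobolevJets

end

theorem theoremt (a b : ℝ) (hab : a < b) (d m N : ℕ)
    (G : Set (EuclideanSpace ℝ (Fin d))) (hG : IsOpen G)
    (f : EuclideanSpace ℝ (Fin d) → EuclideanSpace ℝ (Fin m)) (hf : IsCb N f G) :
    -- the superposition operator from `H_1` into `L₂`
    (∀ 𝒢 : Set (Sobolev a b 1 d), IsOpen 𝒢 → Bornology.IsBounded 𝒢 →
      𝒢 ⊆ Sobolev.continuousInto a b 1 G →
      ∃ Φ : Sobolev a b 1 d → L2Space a b (EuclideanSpace ℝ (Fin m)),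
        (∀ u ∈ 𝒢, Φ u =ᵐ[volume.restrict (Icc a b)] fun x => f (u.toL2 x)) ∧
        IsCb N Φ 𝒢 ∧
        ∀ j ≤ N, ∀ u ∈ 𝒢, ∀ h : Fin j → Sobolev a b 1 d,
          iteratedFDeriv ℝ j Φ u h =ᵐ[volume.restrict (Icc a b)]
            fun x => iteratedFDeriv ℝ j f (u.toL2 x) (fun i => (h i).toL2 x)) ∧
    -- the superposition operator from `H_l` into `H_l`
    (∀ l : ℕ, 1 ≤ l → l ≤ N →
      ∀ 𝒢 : Set (Sobolev a b l d), IsOpen 𝒢 → Bornology.IsBounded 𝒢 →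
      𝒢 ⊆ Sobolev.continuousInto a b l G →
      ∃ Φ : Sobolev a b l d → Sobolev a b l m,
        (∀ u ∈ 𝒢, (Φ u).toL2 =ᵐ[volume.restrict (Icc a b)] fun x => f (u.toL2 x)) ∧
        ∀ k : ℕ, k + l ≤ N →
          IsCb k Φ 𝒢 ∧
          ∀ j ≤ k, ∀ u ∈ 𝒢, ∀ h : Fin j → Sobolev a b l d,
            (iteratedFDeriv ℝ j Φ u h).toL2 =ᵐ[volume.restrict (Icc a b)]
              fun x => iteratedFDeriv ℝ j f (u.toL2 x) (fun i => (h i).toL2 x)) := by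
  have hfc := hf.extendsBounded.continuousOn
  constructor
  · intro 𝒢 h𝒢 _ h𝒢G
    have hu := fun u hu => sobolevCont_mem_of_mem_continuousInto hab one_pos (u := u) (h𝒢G hu)
    refine ⟨fun u => continuousToLp hab.le 2 (superpose f (sobolevCont hab ⟨0, one_pos⟩ u)),
      fun u hu' => continuousToLp_superpose_ae_eq hab hfc one_pos (hu u hu'),
      (hf.superpose_comp hG _ h𝒢 hu).clm_comp h𝒢 _, fun j hj u hu' h => ?_⟩
    exact iteratedFDeriv_superpose_sobolevCont_ae_eq hab hG (hf.mono_order hj) one_pos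
      (hu u hu') h
  · intro l hl hlN 𝒢 h𝒢 h𝒢b h𝒢G
    have hu := fun u hu => sobolevCont_mem_of_mem_continuousInto hab hl (u := u) (h𝒢G hu)
    obtain ⟨R, hR⟩ := exists_sobolevJet_mem_jetDomain hab hl h𝒢b h𝒢G
    obtain ⟨P, hP⟩ := exists_projection_sobolev (a := a) (b := b) (l := l) (m := m)
    let e := (PiLp.continuousLinearEquiv 2 ℝ
      fun _ : Fin (l + 1) => L2Space a b (EuclideanSpace ℝ (Fin m))).symm
    -- The projection makes `Φ` total with values in the Sobolev space; on `𝒢` it changes nothing,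
    -- since the tuple there already consists of weak derivatives.
    let Φ : Sobolev a b l d → Sobolev a b l m := fun u => P (e (superposeDeriv hab f hl u))
    have hΦ : ∀ u ∈ 𝒢, (Φ u).1 = e (superposeDeriv hab f hl u) := fun u hu' =>
      congrArg Subtype.val (hP ⟨e (superposeDeriv hab f hl u), fun i =>
        isWeakDeriv_superposeDeriv hab hG hf hl hlN (hR u hu') i⟩)
    have hΦ0 : EqOn (fun u => sobolevDeriv 0 (Φ u))
        (fun u => continuousToLp hab.le 2 (superpose f (sobolevCont hab ⟨0, hl⟩ u))) 𝒢 := by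
      intro u hu'
      change (Φ u).1 0 = _
      rw [hΦ u hu']
      rfl
    refine ⟨Φ, fun u hu' => ?_, fun k hk => ?_⟩
    · change sobolevDeriv 0 (Φ u) =ᵐ[_] _
      rw [show sobolevDeriv 0 (Φ u) = _ from hΦ0 hu']
      exact continuousToLp_superpose_ae_eq hab hfc hl (hu u hu')
    · have hCb : IsCb k Φ 𝒢 := (IsCb.pi h𝒢 fun i =>
        isCb_superposeDeriv hab hG hf hl hk h𝒢 h𝒢b hR i).clm_comp h𝒢
          (P.comp e.toContinuousLinearMap)
      refine ⟨hCb, fun j hj u hu' h => ?_⟩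
      have hc : ContDiffAt ℝ j Φ u :=
        (hCb.mono_order hj).contDiffOn.contDiffAt (h𝒢.mem_nhds hu')
      -- Taking the entry of index `0` is linear and commutes with differentiation, which reduces
      -- the formula to the case of the target $L_2$.
      have h1 := ContinuousLinearMap.iteratedFDeriv_comp_left (sobolevDeriv 0) hc le_rfl
      have h2 := ((hΦ0.eventuallyEq_of_mem (h𝒢.mem_nhds hu')).iteratedFDeriv ℝ j).eq_of_nhds
      have h3 : (iteratedFDeriv ℝ j Φ u h).toL2 = iteratedFDeriv ℝ j
          (fun u => continuousToLp hab.le 2 (superpose f (sobolevCont hab ⟨0, hl⟩ u))) u h := by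
        rw [← h2]
        exact (congrArg (fun A => A h) h1).symm
      rw [h3]
      exact iteratedFDeriv_superpose_sobolevCont_ae_eq hab hG (hf.mono_order (by omega)) hl
        (hu u hu') h
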